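/- Let $d_1,d_2\in\{0,1,2,\dots\}$, $d=d_1+d_2$, and let $\mathrm E(d)$ be the group of Euclidean isometries of $\mathbb R^d$; for $g\in \mathrm E(d)$ let $\mathrm{rot}(g)\in \mathrm O(d)$ be its linear component. A subgroup of $\mathrm E(d)$ is discrete if all its orbits are discrete sets; a $d_2$-dimensional space group is a discrete subgroup of $\mathrm E(d_2)$ containing $d_2$ translations with linearly independent translation vectors. Let $\mathcal S<\mathrm E(d_2)$ be a space group and $\mathcal G<\mathrm O(d_1)\oplus\mathcal S$ a discrete subgroup of $\mathrm E(d)$ with $\pi(\mathcal G)=\mathcal S$, where $A\oplus h$ acts by $(x,y)\mapsto(Ax,h\cdot y)$ on $\mathbb R^{d_1}\times\mathbb R^{d_2}$ and $\pi(A\oplus h)=h$. Let $x_0\in\mathbb R^d$ be such that $g\mapsto g\cdot x_0$ is injective on $\mathcal G$. Let $\mathcal T\subset\mathcal G$ be a set which $\pi$ maps bijectively onto the translations in $\mathcal S$, put $\mathcal T^N=\{t^N: t\in\mathcal T\}$, and let $M_0$ be the set of all integers $N\ge1$ for which $\mathcal T^N$ is a normal subgroup of $\mathcal G$. For $N\in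 M_0$ let $\mathcal C_N$ be a representation set of $\mathcal G/\mathcal T^N$. Call $u:\mathcal G\to\mathbb R^d$ $\mathcal T^N$-periodic if $u(gt)=u(g)$ for all $g\in\mathcal G$, $t\in\mathcal T^N$, and let $U_{\mathrm{per}}$ be the set of all $u$ that are $\mathcal T^N$-periodic for some $N\in M_0$. For $\mathcal R\subset\mathcal G$ let $U_{\mathrm{trans}}(\mathcal R)$ be the space of all $u:\mathcal R\to\mathbb R^d$ for which $\mathrm{rot}(g)u(g)$ is constant in $g\in\mathcal R$. Let $U_{\mathrm{rot}}(\mathcal R)$, $U_{\mathrm{rot},0}(\mathcal R)$ and $U_{\mathrm{rot},0,0}(\mathcal R)$ be the spaces of all $u:\mathcal R\to\mathbb R^d$ such that, for some matrix $S$, $\mathrm{rot}(g)u(g)=S(g\cdot x_0-x_0)$ for all $g\in\mathcal R$, where $S$ ranges, respectively, over all skew symmetric $d\times d$ matrices, over the matrices $\begin{pmatrix}S_1&S_2\\-S_2^T&0\end{pmatrix}$ with $S_1\in\mathbb R^{d_1\times d_1}$ skew symmetric and $S_2\in\mathbb R^{d_1\times d_2}$, and over the matrices $\begin{pmatrix}S_1&0\\0&0\end{pmatrix}$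 with $S_1\in\mathbb R^{d_1\times d_1}$ skew symmetric. Put $U_{\mathrm{iso}}=U_{\mathrm{trans}}+U_{\mathrm{rot}}$, $U_{\mathrm{iso},0}=U_{\mathrm{trans}}+U_{\mathrm{rot},0}$ and $U_{\mathrm{iso},0,0}=U_{\mathrm{trans}}+U_{\mathrm{rot},0,0}$; when $\mathcal R$ is omitted it is $\mathcal G$. For finite $\mathcal R\subset\mathcal G$ and a subspace $U$ of the space of maps $\mathcal R\to\mathbb R^d$, let $\pi_U$ be the orthogonal projection with kernel $U$ for the norm $\|w\|=(\sum_{g\in\mathcal R}\|w(g)\|^2)^{1/2}$, and let $\nabla_{\mathcal R}u(g)$ be the map $h\mapsto u(gh)-\mathrm{rot}(h)^Tu(g)$ on $\mathcal R$. For $u\in U_{\mathrm{per}}$ that is $\mathcal T^N$-periodic with $N\in M_0$, set $$\|u\|_{\mathcal R}=\Big(\tfrac1{|\mathcal C_N|}\sum_{g\in\mathcal C_N}\|\pi_{U_{\mathrm{iso}}(\mathcal R)}(u(g\,\cdot)|_{\mathcal R})\|^2\Big)^{1/2},\qquad \|\nabla u\|_{\mathcal R}=\Big(\tfrac1{|\mathcal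 C_N|}\sum_{g\in\mathcal C_N}\|\pi_{U_{\mathrm{rot}}(\mathcal R)}(\nabla_{\mathcal R}u(g))\|^2\Big)^{1/2},$$ and define $\|u\|_{\mathcal R,0}$ and $\|\nabla u\|_{\mathcal R,0}$ in the same way with $U_{\mathrm{iso},0}(\mathcal R)$ and $U_{\mathrm{rot},0}(\mathcal R)$ in place of $U_{\mathrm{iso}}(\mathcal R)$ and $U_{\mathrm{rot}}(\mathcal R)$. These are seminorms on $U_{\mathrm{per}}$ that do not depend on the choice of $N$ and $\mathcal C_N$. A set $\mathcal R\subset\mathcal G$ has Property 1 if it is finite, contains $\mathrm{id}$, and $\mathcal R\cdot x_0$ and $\mathcal G\cdot x_0$ have the same affine hull. It has Property 2 if it is finite and there are $\mathcal R',\mathcal R''\subset\mathcal G$ such that $\mathrm{id}\in\mathcal R'$, $\mathcal R'$ generates $\mathcal G$, $\mathcal R''$ has Property 1, and $\mathcal R'\mathcal R''\subset\mathcal R$. **Theorem.** If $\mathcal R_1,\mathcal R_2\subset\mathcal G$ have Property 2, then the eight seminorms $\|\cdot\|_{\mathcal R_i}$, $\|\cdot\|_{\mathcal R_i,0}$, $\|\nabla\cdot\|_{\mathcal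 R_i}$, $\|\nabla\cdot\|_{\mathcal R_i,0}$, $i=1,2$, on $U_{\mathrm{per}}$ are mutually equivalent (each is bounded above and below by positive constants, independent of $u$ and of its period, times any other), and each of them has the kernel $U_{\mathrm{iso},0,0}\cap U_{\mathrm{per}}$. -/

import Mathlib

open scoped Pointwise

noncomputable section

namespace ObjStruct

/-! ## Euclidean isometries -/

/-- The Euclidean group of `ℝ^ι` (with its Euclidean norm): the group of affine isometries;
the product is composition. -/
abbrev EIso (ι : Type) [Fintype ι] : Type :=
  EuclideanSpace ℝ ι ≃ᵃⁱ[ℝ] EuclideanSpace ℝ ι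

/-- The linear component of a Euclidean isometry. -/
abbrev rot {ι : Type} [Fintype ι] (g : EIso ι) : EuclideanSpace ℝ ι ≃ₗᵢ[ℝ] EuclideanSpace ℝ ι :=
  g.linearIsometryEquiv

/-- The translation by `v`. -/
abbrev translation {ι : Type} [Fintype ι] (v : EuclideanSpace ℝ ι) : EIso ι :=
  AffineIsometryEquiv.constVAdd ℝ (EuclideanSpace ℝ ι) v

/-- A group of Euclidean isometries is discrete if all its orbits are discrete sets. -/
def IsDiscreteGroup {ι : Type} [Fintype ι] (G : Subgroup (EIso ι)) : Prop :=
  ∀ x : EuclideanSpace ℝ ι, IsDiscrete (Set.range fun g : G => (g : EIso ι) x)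

/-- A space group in dimension `n`: a discrete group of isometries of `ℝⁿ` which contains `n`
translations with linearly independent translation vectors. -/
def IsSpaceGroup {n : ℕ} (S : Subgroup (EIso (Fin n))) : Prop :=
  IsDiscreteGroup S ∧
    ∃ v : Fin n → EuclideanSpace ℝ (Fin n),
      LinearIndependent ℝ v ∧ ∀ i, translation (v i) ∈ S

/-! ## The sum `A ⊕ h` of `A ∈ O(d₁)` and `h ∈ E(d₂)` -/

/-- The vector `(x, y) ∈ ℝ^{d₁} × ℝ^{d₂}`. -/
def joinVec {d₁ d₂ : ℕ} (x : EuclideanSpace ℝ (Fin d₁)) (y : EuclideanSpace ℝ (Fin d₂)) :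
    EuclideanSpace ℝ (Fin d₁ ⊕ Fin d₂) :=
  WithLp.toLp 2 (Sum.elim x y)

/-- `ProjectsTo g h` says that `g = A ⊕ h` for some `A ∈ O(d₁)`, that is, that `g` lies in
`O(d₁) ⊕ E(d₂)` and that its image under the natural projection `π : O(d₁) ⊕ E(d₂) → E(d₂)`
is `h`. -/
def ProjectsTo {d₁ d₂ : ℕ} (g : EIso (Fin d₁ ⊕ Fin d₂)) (h : EIso (Fin d₂)) : Prop :=
  ∃ A : EuclideanSpace ℝ (Fin d₁) ≃ₗᵢ[ℝ] EuclideanSpace ℝ (Fin d₁),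
    ∀ x y, g (joinVec x y) = joinVec (A x) (h y)

/-- `T ⊆ G` is a section of the translation subgroup of `S`: the projection `π` maps `T`
bijectively onto the set of translations in `S`. -/
def IsTranslationSection {d₁ d₂ : ℕ} {G : Subgroup (EIso (Fin d₁ ⊕ Fin d₂))}
    (S : Subgroup (EIso (Fin d₂))) (T : Set G) : Prop :=
  (∀ t ∈ T, ∃ v, translation v ∈ S ∧ ProjectsTo (t : EIso (Fin d₁ ⊕ Fin d₂)) (translation v)) ∧
    ∀ v, translation v ∈ S →
      ∃! t : G, t ∈ T ∧ ProjectsTo (t : EIso (Fin d₁ ⊕ Fin d₂)) (translation v)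

/-! ## Periodic functions and their averages -/

section Periodic

variable {G : Type*} [Group G]

/-- `T ^ N = {t ^ N | t ∈ T}` (elementwise powers). -/
def powSet (T : Set G) (N : ℕ) : Set G := (fun t => t ^ N) '' T

/-- The set of all `N ≥ 1` for which `T ^ N` is a normal subgroup. -/
def admissible (T : Set G) : Set ℕ :=
  {N | 1 ≤ N ∧ ∃ H : Subgroup G, H.Normal ∧ (H : Set G) = powSet T N}

/-- `u` is `T ^ N`-periodic. -/
def IsPeriodicWith {X : Type*} (T : Set G) (N : ℕ) (u : G → X) : Prop :=
  ∀ g, ∀ t ∈ powSet T N, u g = u (g * t)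

/-- `u` is periodic: it is `T ^ N`-periodic for some admissible `N`. -/
def IsPeriodic {X : Type*} (T : Set G) (u : G → X) : Prop :=
  ∃ N ∈ admissible T, IsPeriodicWith T N u

/-- An admissible `N` for which the periodic function `u` is `T ^ N`-periodic (the least one; by
`average_eq_average` below the choice does not matter). -/
def period {X : Type*} (T : Set G) (u : G → X) : ℕ :=
  sInf {N | N ∈ admissible T ∧ IsPeriodicWith T N u}

lemma period_spec {X : Type*} {T : Set G} {u : G → X} (hu : IsPeriodic T u) :
    period T u ∈ admissible T ∧ IsPeriodicWith T (period T u) u :=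
  Nat.sInf_mem (s := {N | N ∈ admissible T ∧ IsPeriodicWith T N u}) hu

/-- `(1 / |D|) ∑_{g ∈ D} f g`. -/
def average (D : Set G) (f : G → ℝ) : ℝ := (1 / (D.ncard : ℝ)) * ∑ᶠ g ∈ D, f g

/-- `C` consists of representation sets `C N` of the cosets `g T ^ N`, for all admissible `N`. -/
def IsRepresentationFamily (T : Set G) (C : ℕ → Set G) : Prop :=
  ∀ N ∈ admissible T, Subgroup.IsComplement (C N) (powSet T N)

lemma average_eq_quotient {H : Subgroup G} {D : Set G}
    (hD : Subgroup.IsComplement D (H : Set G)) (f : G → ℝ) (F : G ⧸ H → ℝ)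
    (hF : ∀ g : G, F (g : G ⧸ H) = f g) :
    average D f = (1 / (Nat.card (G ⧸ H) : ℝ)) * ∑ᶠ q, F q := by
  have e := hD.leftQuotientEquiv
  rw [average, Nat.card_congr e, Nat.card_coe_set_eq, ← finsum_set_coe_eq_finsum_mem]
  congr 1
  rw [← finsum_comp_equiv hD.leftQuotientEquiv]
  refine finsum_congr fun q => ?_
  obtain ⟨d, rfl⟩ := hD.leftQuotientEquiv.symm.surjective q
  rw [Equiv.apply_symm_apply, ← hF]
  congr 1

lemma average_quotient_le {H L : Subgroup G} (h : H ≤ L) [Finite (G ⧸ H)]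
    (F : G ⧸ H → ℝ) (F' : G ⧸ L → ℝ) (hF : ∀ g : G, F (g : G ⧸ H) = F' (g : G ⧸ L)) :
    (1 / (Nat.card (G ⧸ H) : ℝ)) * ∑ᶠ q, F q = (1 / (Nat.card (G ⧸ L) : ℝ)) * ∑ᶠ q, F' q := by
  have e := Subgroup.quotientEquivProdOfLE h
  have hf : Finite ((G ⧸ L) × (L ⧸ H.subgroupOf L)) := Finite.of_equiv _ e
  have : Finite (G ⧸ L) := Finite.of_surjective
    (fun q : (G ⧸ L) × (L ⧸ H.subgroupOf L) => q.1) Prod.fst_surjective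
  have : Finite (L ⧸ H.subgroupOf L) := Finite.of_surjective
    (fun q : (G ⧸ L) × (L ⧸ H.subgroupOf L) => q.2) Prod.snd_surjective
  cases nonempty_fintype (G ⧸ L)
  cases nonempty_fintype (G ⧸ H)
  cases nonempty_fintype (L ⧸ H.subgroupOf L)
  rw [Nat.card_congr e, Nat.card_prod, finsum_eq_sum_of_fintype, finsum_eq_sum_of_fintype]
  have : ∑ q, F q = ∑ p : (G ⧸ L) × (L ⧸ H.subgroupOf L), F' p.1 := by
    refine Fintype.sum_equiv (Subgroup.quotientEquivProdOfLE h) _ _ ?_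
    intro q
    induction q using QuotientGroup.induction_on with
    | H g => exact hF g
  rw [this, Fintype.sum_prod_type]
  simp only [Finset.sum_const, Finset.card_univ, nsmul_eq_mul, ← Finset.mul_sum,
    Nat.card_eq_fintype_card]
  have h0 : (Fintype.card (L ⧸ H.subgroupOf L) : ℝ) ≠ 0 := by
    exact_mod_cast Fintype.card_ne_zero
  push_cast
  field_simp

/-- The average of a periodic function does not depend on the choice of the period `N` and of the
(finite) representation set of the cosets. -/
lemma average_eq_average {T : Set G} {N M : ℕ} (hN : N ∈ admissible T) (hM : M ∈ admissible T)
    {D D' : Set G} (hD : Subgroup.IsComplement D (powSet T N))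
    (hD' : Subgroup.IsComplement D' (powSet T M)) (hfin : D.Finite) (hfin' : D'.Finite)
    {f : G → ℝ} (hf : IsPeriodicWith T N f) (hf' : IsPeriodicWith T M f) :
    average D f = average D' f := by
  obtain ⟨-, H, -, hH⟩ := hN
  obtain ⟨-, K, -, hK⟩ := hM
  rw [← hH] at hD
  rw [← hK] at hD'
  let P : Subgroup G :=
    { carrier := {t | ∀ g, f (g * t) = f g}
      one_mem' := fun g => by rw [mul_one]
      mul_mem' := fun {a b} ha hb g => by rw [← mul_assoc, hb, ha]
      inv_mem' := fun {a} ha g => by rw [← ha (g * a⁻¹), inv_mul_cancel_right] }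
  have hHP : H ≤ P := fun t ht g => (hf g t (hH ▸ ht)).symm
  have hKP : K ≤ P := fun t ht g => (hf' g t (hK ▸ ht)).symm
  have lift : ∀ L : Subgroup G, L ≤ P → ∃ F : G ⧸ L → ℝ, ∀ g : G, F (g : G ⧸ L) = f g := by
    intro L hL
    refine ⟨fun q => Quotient.liftOn' q f ?_, fun g => rfl⟩
    intro a b hab
    have h1 := hL (QuotientGroup.leftRel_apply.mp hab) a
    rw [mul_inv_cancel_left] at h1
    exact h1.symm
  obtain ⟨F, hF⟩ := lift P le_rfl
  obtain ⟨F₁, hF₁⟩ := lift H hHP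
  obtain ⟨F₂, hF₂⟩ := lift K hKP
  have : Finite D := hfin
  have : Finite D' := hfin'
  have : Finite (G ⧸ H) := Finite.of_equiv D hD.leftQuotientEquiv.symm
  have : Finite (G ⧸ K) := Finite.of_equiv D' hD'.leftQuotientEquiv.symm
  rw [average_eq_quotient hD f F₁ hF₁, average_eq_quotient hD' f F₂ hF₂,
    average_quotient_le hHP F₁ F (fun g => by rw [hF₁, hF]),
    average_quotient_le hKP F₂ F (fun g => by rw [hF₂, hF])]

end Periodic

/-! ## Infinitesimal rigid motions -/

section Rigid

variable {d₁ d₂ : ℕ}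

/-- The real skew symmetric matrices; `Skew(d)` with `d = d₁ + d₂` is `skew (Fin d₁ ⊕ Fin d₂)`. -/
def skew (ι : Type) [Fintype ι] : Submodule ℝ (Matrix ι ι ℝ) where
  carrier := {S | S.transpose = -S}
  zero_mem' := by simp
  add_mem' := by
    intro a b ha hb
    simp only [Set.mem_ofPred_eq] at ha hb ⊢
    rw [Matrix.transpose_add, ha, hb, neg_add]
  smul_mem' := by
    intro c a ha
    simp only [Set.mem_ofPred_eq] at ha ⊢
    rw [Matrix.transpose_smul, ha, smul_neg]

/-- `Skew_{0,d₂}(d)`: the matrices `(S₁, S₂; -S₂ᵀ, 0)` with `S₁ ∈ Skew(d₁)` and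
`S₂ ∈ ℝ^{d₁ × d₂}`. -/
def skewZero (d₁ d₂ : ℕ) : Submodule ℝ (Matrix (Fin d₁ ⊕ Fin d₂) (Fin d₁ ⊕ Fin d₂) ℝ) where
  carrier := {S | ∃ S₁ ∈ skew (Fin d₁), ∃ S₂ : Matrix (Fin d₁) (Fin d₂) ℝ,
    S = Matrix.fromBlocks S₁ S₂ (-S₂.transpose) 0}
  zero_mem' := ⟨0, zero_mem _, 0, by simp⟩
  add_mem' := by
    rintro _ _ ⟨A, hA, B, rfl⟩ ⟨A', hA', B', rfl⟩
    refine ⟨A + A', add_mem hA hA', B + B', ?_⟩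
    rw [Matrix.fromBlocks_add, Matrix.transpose_add, neg_add, add_zero]
  smul_mem' := by
    rintro c _ ⟨A, hA, B, rfl⟩
    refine ⟨c • A, Submodule.smul_mem _ c hA, c • B, ?_⟩
    rw [Matrix.fromBlocks_smul, Matrix.transpose_smul, smul_neg, smul_zero]

/-- The matrices `S ⊕ 0_{d₂,d₂}` with `S ∈ Skew(d₁)`. -/
def skewZeroZero (d₁ d₂ : ℕ) :
    Submodule ℝ (Matrix (Fin d₁ ⊕ Fin d₂) (Fin d₁ ⊕ Fin d₂) ℝ) where
  carrier := {S | ∃ S₁ ∈ skew (Fin d₁), S = Matrix.fromBlocks S₁ 0 0 0}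
  zero_mem' := ⟨0, zero_mem _, by simp⟩
  add_mem' := by
    rintro _ _ ⟨A, hA, rfl⟩ ⟨A', hA', rfl⟩
    refine ⟨A + A', add_mem hA hA', ?_⟩
    rw [Matrix.fromBlocks_add, add_zero, add_zero, add_zero]
  smul_mem' := by
    rintro c _ ⟨A, hA, rfl⟩
    refine ⟨c • A, Submodule.smul_mem _ c hA, ?_⟩
    rw [Matrix.fromBlocks_smul, smul_zero, smul_zero, smul_zero]

/-- The space `ℝ^d` with `d = d₁ + d₂`. -/
abbrev Vec (d₁ d₂ : ℕ) : Type := EuclideanSpace ℝ (Fin d₁ ⊕ Fin d₂)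

variable {G : Subgroup (EIso (Fin d₁ ⊕ Fin d₂))}

/-- `U_trans(R)`: the maps `u : R → ℝ^d` for which `rot(g) u(g)` is constant. -/
def Utrans (R : Set G) : Submodule ℝ (R → Vec d₁ d₂) where
  carrier := {u | ∃ a : Vec d₁ d₂, ∀ g : R, rot (g : EIso (Fin d₁ ⊕ Fin d₂)) (u g) = a}
  zero_mem' := ⟨0, fun g => by simp⟩
  add_mem' := by
    rintro u v ⟨a, ha⟩ ⟨b, hb⟩
    exact ⟨a + b, fun g => by rw [Pi.add_apply, map_add, ha, hb]⟩
  smul_mem' := by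
    rintro c u ⟨a, ha⟩
    exact ⟨c • a, fun g => by rw [Pi.smul_apply, map_smul, ha]⟩

/-- The maps `u : R → ℝ^d` for which there is a matrix `S` in `K` with
`rot(g) u(g) = S (g · x₀ - x₀)` for all `g ∈ R`. For `K = Skew(d)` this is `U_rot(R)`, for
`K = Skew_{0,d₂}(d)` it is `U_{rot,0}(R)`, and for `K = Skew(d₁) ⊕ 0` it is `U_{rot,0,0}(R)`. -/
def Urot (x₀ : Vec d₁ d₂) (K : Submodule ℝ (Matrix (Fin d₁ ⊕ Fin d₂) (Fin d₁ ⊕ Fin d₂) ℝ))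
    (R : Set G) : Submodule ℝ (R → Vec d₁ d₂) where
  carrier := {u | ∃ S ∈ K, ∀ g : R, rot (g : EIso (Fin d₁ ⊕ Fin d₂)) (u g) =
    Matrix.toEuclideanLin S ((g : EIso (Fin d₁ ⊕ Fin d₂)) x₀ - x₀)}
  zero_mem' := ⟨0, zero_mem _, fun g => by simp⟩
  add_mem' := by
    rintro u v ⟨S, hS, hu⟩ ⟨S', hS', hv⟩
    exact ⟨S + S', add_mem hS hS', fun g => by
      rw [Pi.add_apply, map_add, hu, hv, map_add, LinearMap.add_apply]⟩
  smul_mem' := by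
    rintro c u ⟨S, hS, hu⟩
    exact ⟨c • S, Submodule.smul_mem _ c hS, fun g => by
      rw [Pi.smul_apply, map_smul, hu, map_smul, LinearMap.smul_apply]⟩

/-- `U_trans(R) + U_rot(R)`, with the rotations generated by the matrices in `K`. For the three
spaces `K` named at `Urot` this is `U_iso(R)`, `U_{iso,0}(R)` and `U_{iso,0,0}(R)`. -/
def Uiso (x₀ : Vec d₁ d₂) (K : Submodule ℝ (Matrix (Fin d₁ ⊕ Fin d₂) (Fin d₁ ⊕ Fin d₂) ℝ))
    (R : Set G) : Submodule ℝ (R → Vec d₁ d₂) :=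
  Utrans R ⊔ Urot x₀ K R

/-- `U_{iso,0,0}`: the space `U_{iso,0,0}(R)` for `R = G`, as a set of functions on `G`. -/
def Uiso00 (x₀ : Vec d₁ d₂) : Set (G → Vec d₁ d₂) :=
  {u | (fun g : (Set.univ : Set G) => u g) ∈ Uiso x₀ (skewZeroZero d₁ d₂) (Set.univ : Set G)}

/-- `U_per`: the periodic functions `u : G → ℝ^d`. -/
def Uper (T : Set G) : Set (G → Vec d₁ d₂) := {u | IsPeriodic T u}

/-! ## The seminorms -/

/-- `‖π_U(w)‖`, where `π_U` is the orthogonal projection with kernel `U` on the space of all maps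
`R → ℝ^d` with the norm `(∑_{g ∈ R} ‖w(g)‖²)^{1/2}`. -/
def projNorm {R : Finset G} (U : Submodule ℝ (R → Vec d₁ d₂)) (w : R → Vec d₁ d₂) : ℝ :=
  ‖((U.comap (WithLp.linearEquiv 2 ℝ (R → Vec d₁ d₂)).toLinearMap)ᗮ).starProjection
    (WithLp.toLp 2 w : PiLp 2 fun _ : R => Vec d₁ d₂)‖

/-- The discrete derivative: `∇_R u(g)` maps `h ∈ R` to `u(gh) - rot(h)ᵀ u(g)`. -/
def discreteDeriv (R : Finset G) (u : G → Vec d₁ d₂) (g : G) : R → Vec d₁ d₂ :=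
  fun h => u (g * h) - (rot (h : EIso (Fin d₁ ⊕ Fin d₂))).symm (u g)

/-- `u ↦ ((1 / |C_N|) ∑_{g ∈ C_N} ‖π_{U_iso(R)}(u(g ·)|_R)‖²)^{1/2}` if `u` is `T ^ N`-periodic.
This is `‖·‖_R` for `K = Skew(d)` and `‖·‖_{R,0}` for `K = Skew_{0,d₂}(d)`. -/
def rigidityNorm (T : Set G) (C : ℕ → Set G) (x₀ : Vec d₁ d₂)
    (K : Submodule ℝ (Matrix (Fin d₁ ⊕ Fin d₂) (Fin d₁ ⊕ Fin d₂) ℝ)) (R : Finset G)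
    (u : G → Vec d₁ d₂) : ℝ :=
  Real.sqrt (average (C (period T u)) fun g =>
    projNorm (Uiso x₀ K (R : Set G)) (fun h : R => u (g * h)) ^ 2)

/-- `u ↦ ((1 / |C_N|) ∑_{g ∈ C_N} ‖π_{U_rot(R)}(∇_R u(g))‖²)^{1/2}` if `u` is `T ^ N`-periodic.
This is `‖∇·‖_R` for `K = Skew(d)` and `‖∇·‖_{R,0}` for `K = Skew_{0,d₂}(d)`. -/
def gradRigidityNorm (T : Set G) (C : ℕ → Set G) (x₀ : Vec d₁ d₂)
    (K : Submodule ℝ (Matrix (Fin d₁ ⊕ Fin d₂) (Fin d₁ ⊕ Fin d₂) ℝ)) (R : Finset G)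
    (u : G → Vec d₁ d₂) : ℝ :=
  Real.sqrt (average (C (period T u)) fun g =>
    projNorm (Urot x₀ K (R : Set G)) (discreteDeriv R u g) ^ 2)

/-- The two functions `p` and `q` are equivalent on the set `U`. -/
def EquivalentOn {X : Type*} (U : Set X) (p q : X → ℝ) : Prop :=
  ∃ c C : ℝ, 0 < c ∧ 0 < C ∧ ∀ u ∈ U, c * p u ≤ q u ∧ q u ≤ C * p u

/-! ## Richness of the interaction range -/

/-- The orbit part `R · x₀ = {g · x₀ | g ∈ R}`. -/
def orbitSet (x₀ : Vec d₁ d₂) (R : Set G) : Set (Vec d₁ d₂) :=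
  (fun g : G => (g : EIso (Fin d₁ ⊕ Fin d₂)) x₀) '' R

/-- Property 1. -/
def Property1 (x₀ : Vec d₁ d₂) (R : Set G) : Prop :=
  R.Finite ∧ 1 ∈ R ∧
    affineSpan ℝ (orbitSet x₀ R) = affineSpan ℝ (orbitSet x₀ (Set.univ : Set G))

/-- Property 2. -/
def Property2 (x₀ : Vec d₁ d₂) (R : Set G) : Prop :=
  R.Finite ∧ ∃ R' R'' : Set G,
    1 ∈ R' ∧ Subgroup.closure R' = ⊤ ∧ Property1 x₀ R'' ∧ R' * R'' ⊆ R

/-- The eight seminorms `‖·‖_{R₁}`, `‖·‖_{R₂}`, `‖·‖_{R₁,0}`, `‖·‖_{R₂,0}`, `‖∇·‖_{R₁}`, `‖∇·‖_{R₂}`,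
`‖∇·‖_{R₁,0}` and `‖∇·‖_{R₂,0}`. -/
def eightSeminorms (T : Set G) (C : ℕ → Set G) (x₀ : Vec d₁ d₂) (R₁ R₂ : Finset G) :
    Set ((G → Vec d₁ d₂) → ℝ) :=
  {rigidityNorm T C x₀ (skew (Fin d₁ ⊕ Fin d₂)) R₁,
    rigidityNorm T C x₀ (skew (Fin d₁ ⊕ Fin d₂)) R₂,
    rigidityNorm T C x₀ (skewZero d₁ d₂) R₁,
    rigidityNorm T C x₀ (skewZero d₁ d₂) R₂,
    gradRigidityNorm T C x₀ (skew (Fin d₁ ⊕ Fin d₂)) R₁,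
    gradRigidityNorm T C x₀ (skew (Fin d₁ ⊕ Fin d₂)) R₂,
    gradRigidityNorm T C x₀ (skewZero d₁ d₂) R₁,
    gradRigidityNorm T C x₀ (skewZero d₁ d₂) R₂}

end Rigid

end ObjStruct

end

noncomputable section

namespace ObjStruct

open Filter Topology
open scoped RealInnerProductSpace

/-! ## Vectors and skew symmetric matrices in block form -/

section Blocks

variable {d₁ d₂ : ℕ}

/-! Each of the eight seminorms is the root mean square over `g` of `‖Λ (u (g ·))‖`, where `Λ` is
linear with finite-dimensional values and its kernel lies between the rigid motions of `R` with
rotation in `skewZero` and those with rotation in `skew`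
(`exists_averageNorm_of_mem_eightSeminorms`). Only this property, `DetectsRigidity`, is used
afterwards, so it suffices to bound one such average by another.

A periodic `u` lives on a finite quotient group `Q` of `G`, and sums over `Q` are invariant under
translation. By Property 2, rigidity on finitely many translates `k R` gives rigidity on any
prescribed finite set, because neighbouring translates overlap in a set with full affine hull
(`exists_finset_agreesOn`). Linear algebra then bounds every functional that vanishes on all rigid
motions, with a constant that does not see `Q`.

The obstacle is the `d₂ × d₂` block of the rotation: one `Λ` may annihilate it while another detects
it. It is controlled by a discrete Korn inequality. Lifts `a i` of independent translations can be
chosen to commute, and some combination of the points `(a i) ^ n • x₀` with coefficients of sum zero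
equals `(0, b i)`. The corresponding difference operators `Θ i j` read off the entry `⟪b j, A (b
i)⟫` of the block, so `Θ i j + Θ j i` vanishes on rigid motions and is bounded locally. Summation by
parts on `Q` (`korn_perm`) bounds all `Θ i j` by these symmetric parts, uniformly in `Q`.

For the kernel, a periodic `u` is bounded. If it is locally rigid it is globally rigid, and
boundedness along the powers of a translation forces its rotation to vanish on `0 ⊕ ℝ^{d₂}`.
Conversely `rot g` preserves this subspace, so all translates of such a `u` are annihilated by `Λ`.
-/

lemma exists_eq_joinVec (z : Vec d₁ d₂) : ∃ x y, z = joinVec x y :=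
  ⟨WithLp.toLp 2 fun i => z (Sum.inl i), WithLp.toLp 2 fun i => z (Sum.inr i), by
    ext i; cases i <;> rfl⟩

lemma joinVec_add (x x' : EuclideanSpace ℝ (Fin d₁)) (y y' : EuclideanSpace ℝ (Fin d₂)) :
    joinVec x y + joinVec x' y' = joinVec (x + x') (y + y') := by
  ext i; cases i <;> rfl

lemma joinVec_sub (x x' : EuclideanSpace ℝ (Fin d₁)) (y y' : EuclideanSpace ℝ (Fin d₂)) :
    joinVec x y - joinVec x' y' = joinVec (x - x') (y - y') := by
  ext i; cases i <;> rfl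

lemma smul_joinVec (c : ℝ) (x : EuclideanSpace ℝ (Fin d₁)) (y : EuclideanSpace ℝ (Fin d₂)) :
    c • joinVec x y = joinVec (c • x) (c • y) := by
  ext i; cases i <;> rfl

lemma joinVec_zero : (joinVec 0 0 : Vec d₁ d₂) = 0 := by
  ext i; cases i <;> rfl

lemma joinVec_injective {x x' : EuclideanSpace ℝ (Fin d₁)} {y y' : EuclideanSpace ℝ (Fin d₂)}
    (h : joinVec x y = joinVec x' y') : x = x' ∧ y = y' := by
  constructor
  · ext i
    exact congrArg (fun z : Vec d₁ d₂ => z (Sum.inl i)) h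
  · ext i
    exact congrArg (fun z : Vec d₁ d₂ => z (Sum.inr i)) h

lemma inner_joinVec (x x' : EuclideanSpace ℝ (Fin d₁)) (y y' : EuclideanSpace ℝ (Fin d₂)) :
    ⟪joinVec x y, joinVec x' y'⟫ = ⟪x, x'⟫ + ⟪y, y'⟫ := by
  simp [PiLp.inner_apply, joinVec]

lemma norm_joinVec_sq (x : EuclideanSpace ℝ (Fin d₁)) (y : EuclideanSpace ℝ (Fin d₂)) :
    ‖joinVec x y‖ ^ 2 = ‖x‖ ^ 2 + ‖y‖ ^ 2 := by
  simp only [← real_inner_self_eq_norm_sq, inner_joinVec]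

/-- The embedding of the second factor. -/
def inrVec (d₁ d₂ : ℕ) : EuclideanSpace ℝ (Fin d₂) →ₗ[ℝ] Vec d₁ d₂ where
  toFun y := joinVec 0 y
  map_add' y y' := by rw [joinVec_add, add_zero]
  map_smul' c y := by simp [smul_joinVec]

lemma inrVec_apply (y : EuclideanSpace ℝ (Fin d₂)) : inrVec d₁ d₂ y = joinVec 0 y := rfl

lemma inner_single_toEuclideanLin {ι : Type} [Fintype ι] [DecidableEq ι] (S : Matrix ι ι ℝ)
    (i j : ι) :
    ⟪EuclideanSpace.single i (1 : ℝ), Matrix.toEuclideanLin S (EuclideanSpace.single j 1)⟫ =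
      S i j := by
  simp [EuclideanSpace.inner_single_left]

lemma mem_skew_iff {ι : Type} [Fintype ι] [DecidableEq ι] {S : Matrix ι ι ℝ} :
    S ∈ skew ι ↔
      ∀ x y, ⟪x, Matrix.toEuclideanLin S y⟫ = -⟪y, Matrix.toEuclideanLin S x⟫ := by
  constructor
  · intro h x y
    have h : S.transpose = -S := h
    have h2 := LinearMap.adjoint_inner_left (Matrix.toEuclideanLin S) y x
    rw [← Matrix.toEuclideanLin_conjTranspose_eq_adjoint,
      Matrix.conjTranspose_eq_transpose_of_trivial, h] at h2
    rw [← h2, map_neg, LinearMap.neg_apply, inner_neg_left, real_inner_comm]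
  · intro h
    change S.transpose = -S
    ext i j
    rw [Matrix.transpose_apply, Matrix.neg_apply, ← inner_single_toEuclideanLin S j i,
      ← inner_single_toEuclideanLin S i j, h]

lemma inrVec_single (j : Fin d₂) :
    inrVec d₁ d₂ (EuclideanSpace.single j 1) = EuclideanSpace.single (Sum.inr j) 1 := by
  ext i; rcases i with i | i <;> simp [inrVec, joinVec]

/-- The coordinate-free form can be tested on the vectors `(0, b i)` of any basis, which are the
directions that the difference operators see. -/
lemma mem_skewZero_iff {S : Matrix (Fin d₁ ⊕ Fin d₂) (Fin d₁ ⊕ Fin d₂) ℝ} :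
    S ∈ skewZero d₁ d₂ ↔ S ∈ skew (Fin d₁ ⊕ Fin d₂) ∧
      ∀ y y', ⟪inrVec d₁ d₂ y, Matrix.toEuclideanLin S (inrVec d₁ d₂ y')⟫ = 0 := by
  constructor
  · rintro ⟨A, hA, B, rfl⟩
    constructor
    · change Matrix.transpose _ = -_
      have hA : A.transpose = -A := hA
      rw [Matrix.fromBlocks_transpose, Matrix.fromBlocks_neg, hA, Matrix.transpose_neg,
        Matrix.transpose_transpose, Matrix.transpose_zero, neg_neg, neg_zero]
    · intro y y'
      simp [PiLp.inner_apply, inrVec, joinVec, Matrix.fromBlocks_mulVec]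
  · rintro ⟨h, h0⟩
    have h : S.transpose = -S := h
    have h' : ∀ i j, S j i = - S i j := fun i j => congrFun (congrFun h i) j
    refine ⟨S.toBlocks₁₁, ?_, S.toBlocks₁₂, ?_⟩
    · change Matrix.transpose _ = -_
      ext i j
      exact h' _ _
    · ext i j
      rcases i with i | i <;> rcases j with j | j
      · rfl
      · rfl
      · exact h' _ _
      · have := h0 (EuclideanSpace.single i 1) (EuclideanSpace.single j 1)
        rwa [inrVec_single, inrVec_single, inner_single_toEuclideanLin] at this

lemma mem_skewZeroZero_iff {S : Matrix (Fin d₁ ⊕ Fin d₂) (Fin d₁ ⊕ Fin d₂) ℝ} :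
    S ∈ skewZeroZero d₁ d₂ ↔ S ∈ skew (Fin d₁ ⊕ Fin d₂) ∧
      ∀ y, Matrix.toEuclideanLin S (inrVec d₁ d₂ y) = 0 := by
  constructor
  · rintro ⟨A, hA, rfl⟩
    constructor
    · change Matrix.transpose _ = -_
      have hA : A.transpose = -A := hA
      simp [Matrix.fromBlocks_transpose, Matrix.fromBlocks_neg, hA]
    · intro y
      ext i
      rcases i with i | i <;>
      simp [inrVec, joinVec, Matrix.fromBlocks_mulVec]
  · rintro ⟨h, h0⟩
    have h : S.transpose = -S := h
    have h' : ∀ i j, S j i = - S i j := fun i j => congrFun (congrFun h i) j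
    have h2 : ∀ i j, S i (Sum.inr j) = 0 := fun i j => by
      rw [← inner_single_toEuclideanLin S, ← inrVec_single, h0, inner_zero_right]
    refine ⟨S.toBlocks₁₁, ?_, ?_⟩
    · change Matrix.transpose _ = -_
      ext i j
      exact h' _ _
    · ext i j
      rcases i with i | i <;> rcases j with j | j
      · rfl
      · exact h2 _ _
      · rw [h' (Sum.inl j), h2]; simp
      · exact h2 _ _

lemma skewZero_le_skew : skewZero d₁ d₂ ≤ skew (Fin d₁ ⊕ Fin d₂) :=
  fun _ h => (mem_skewZero_iff.1 h).1

/-- The conjugate of a matrix by a linear isometry. -/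
def conj {ι : Type} [Fintype ι] [DecidableEq ι] (ρ : EuclideanSpace ℝ ι ≃ₗᵢ[ℝ] EuclideanSpace ℝ ι)
    (S : Matrix ι ι ℝ) : Matrix ι ι ℝ :=
  Matrix.toEuclideanLin.symm (ρ.toLinearEquiv.conj (Matrix.toEuclideanLin S))

lemma toEuclideanLin_conj {ι : Type} [Fintype ι] [DecidableEq ι]
    (ρ : EuclideanSpace ℝ ι ≃ₗᵢ[ℝ] EuclideanSpace ℝ ι) (S : Matrix ι ι ℝ)
    (x : EuclideanSpace ℝ ι) :
    Matrix.toEuclideanLin (conj ρ S) x = ρ (Matrix.toEuclideanLin S (ρ.symm x)) := by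
  rw [conj, LinearEquiv.apply_symm_apply]
  rfl

lemma conj_mem_skew {ι : Type} [Fintype ι] [DecidableEq ι]
    (ρ : EuclideanSpace ℝ ι ≃ₗᵢ[ℝ] EuclideanSpace ℝ ι) {S : Matrix ι ι ℝ} (hS : S ∈ skew ι) :
    conj ρ S ∈ skew ι := by
  rw [mem_skew_iff] at hS ⊢
  intro x y
  have key : ∀ x z, ⟪x, ρ z⟫ = ⟪ρ.symm x, z⟫ := fun x z => by
    rw [← ρ.inner_map_map (ρ.symm x) z, ρ.apply_symm_apply]
  rw [toEuclideanLin_conj, toEuclideanLin_conj, key, key, hS]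

end Blocks

/-! ## The projection onto the space group -/

section Projection

variable {d₁ d₂ : ℕ}

lemma rot_apply_sub {ι : Type} [Fintype ι] (g : EIso ι) (x y : EuclideanSpace ℝ ι) :
    rot g (x - y) = g x - g y :=
  g.map_vsub x y

lemma rot_mul {ι : Type} [Fintype ι] (g h : EIso ι) (x : EuclideanSpace ℝ ι) :
    rot (g * h) x = rot g (rot h x) := by
  have := rot_apply_sub (g * h) x 0
  rw [sub_zero] at this
  rw [this, AffineIsometryEquiv.coe_mul, Function.comp_apply, Function.comp_apply,
    ← rot_apply_sub, ← rot_apply_sub, sub_zero]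

lemma ProjectsTo.mul {g g' : EIso (Fin d₁ ⊕ Fin d₂)} {h h' : EIso (Fin d₂)}
    (H : ProjectsTo g h) (H' : ProjectsTo g' h') : ProjectsTo (g * g') (h * h') := by
  obtain ⟨A, hA⟩ := H
  obtain ⟨A', hA'⟩ := H'
  refine ⟨A'.trans A, fun x y => ?_⟩
  rw [AffineIsometryEquiv.coe_mul, AffineIsometryEquiv.coe_mul, Function.comp_apply, hA', hA]
  rfl

lemma ProjectsTo.one : ProjectsTo (1 : EIso (Fin d₁ ⊕ Fin d₂)) 1 :=
  ⟨LinearIsometryEquiv.refl ℝ _, fun _ _ => rfl⟩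

lemma ProjectsTo.pow {g : EIso (Fin d₁ ⊕ Fin d₂)} {h : EIso (Fin d₂)}
    (H : ProjectsTo g h) (n : ℕ) : ProjectsTo (g ^ n) (h ^ n) := by
  induction n with
  | zero => exact ProjectsTo.one
  | succ n ih => rw [pow_succ, pow_succ]; exact ih.mul H

lemma ProjectsTo.unique {g : EIso (Fin d₁ ⊕ Fin d₂)} {h h' : EIso (Fin d₂)}
    (H : ProjectsTo g h) (H' : ProjectsTo g h') : h = h' := by
  obtain ⟨A, hA⟩ := H
  obtain ⟨A', hA'⟩ := H'
  ext1 y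
  exact (joinVec_injective ((hA 0 y).symm.trans (hA' 0 y))).2

lemma translation_mul {ι : Type} [Fintype ι] (v w : EuclideanSpace ℝ ι) :
    translation v * translation w = translation (v + w) := by
  ext1 x
  simp [translation, add_assoc]

lemma translation_zero {ι : Type} [Fintype ι] :
    translation (0 : EuclideanSpace ℝ ι) = 1 := by
  ext1 x
  simp [translation]

lemma translation_pow {ι : Type} [Fintype ι] (v : EuclideanSpace ℝ ι) (n : ℕ) :
    translation v ^ n = translation ((n : ℝ) • v) := by
  induction n with
  | zero => rw [pow_zero, Nat.cast_zero, zero_smul, translation_zero]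
  | succ n ih => rw [pow_succ, ih, translation_mul]; congr 1; push_cast; rw [add_smul, one_smul]

lemma translation_injective {ι : Type} [Fintype ι] {v w : EuclideanSpace ℝ ι}
    (h : translation v = translation w) : v = w := by
  have := DFunLike.congr_fun h 0
  simpa [translation] using this

lemma ProjectsTo.rot_inrVec {g : EIso (Fin d₁ ⊕ Fin d₂)} {h : EIso (Fin d₂)}
    (H : ProjectsTo g h) (y : EuclideanSpace ℝ (Fin d₂)) :
    rot g (inrVec d₁ d₂ y) = inrVec d₁ d₂ (rot h y) := by
  obtain ⟨A, hA⟩ := H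
  have h0 := rot_apply_sub g (inrVec d₁ d₂ y) 0
  have h1 := rot_apply_sub h y 0
  rw [sub_zero] at h0 h1
  rw [h0, h1, inrVec_apply, inrVec_apply, hA, ← joinVec_zero, hA, joinVec_sub, sub_self]

lemma ProjectsTo.rot_inrVec_of_translation {g : EIso (Fin d₁ ⊕ Fin d₂)}
    {v : EuclideanSpace ℝ (Fin d₂)} (H : ProjectsTo g (translation v))
    (y : EuclideanSpace ℝ (Fin d₂)) :
    rot g (inrVec d₁ d₂ y) = inrVec d₁ d₂ y := by
  rw [H.rot_inrVec]
  rfl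

/-- The powers of a lift `t` of a translation by `b` move every point asymptotically in the
direction `(0, b)`. -/
lemma ProjectsTo.tendsto_inv_smul_pow {t : EIso (Fin d₁ ⊕ Fin d₂)}
    {b : EuclideanSpace ℝ (Fin d₂)} (H : ProjectsTo t (translation b)) (z : Vec d₁ d₂) :
    Tendsto (fun n : ℕ => (n : ℝ)⁻¹ • (t ^ n) z) atTop (𝓝 (inrVec d₁ d₂ b)) := by
  obtain ⟨x, y, rfl⟩ := exists_eq_joinVec z
  -- The difference is `(A x, y)`, with `A` the orthogonal part of `t ^ n`; it has the norm of `(x,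
  -- y)` for every `n`.
  have hbd : ∀ n : ℕ, ‖(t ^ n) (joinVec x y) - (n : ℝ) • inrVec d₁ d₂ b‖ ≤ ‖joinVec x y‖ := by
    intro n
    obtain ⟨A, hA⟩ := H.pow n
    rw [hA, translation_pow, inrVec_apply, smul_joinVec, joinVec_sub]
    refine le_of_eq ?_
    rw [← sq_eq_sq₀ (norm_nonneg _) (norm_nonneg _), norm_joinVec_sq, norm_joinVec_sq]
    simp [translation]
  have h0 : Tendsto (fun n : ℕ => (n : ℝ)⁻¹ • ((t ^ n) (joinVec x y) - (n : ℝ) • inrVec d₁ d₂ b))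
      atTop (𝓝 0) := by
    refine squeeze_zero_norm (a := fun n : ℕ => (n : ℝ)⁻¹ * ‖joinVec x y‖) (fun n => ?_) ?_
    · rw [norm_smul, norm_inv, Real.norm_natCast]
      gcongr
      exact hbd n
    · simpa using (tendsto_inv_atTop_nhds_zero_nat (𝕜 := ℝ)).mul_const ‖joinVec x y‖
  have h1 := h0.add_const (inrVec d₁ d₂ b)
  rw [zero_add] at h1
  refine h1.congr' ?_
  filter_upwards [eventually_ge_atTop 1] with n hn
  rw [smul_sub, inv_smul_smul₀ (by positivity), sub_add_cancel]

/-- `(0, b)` is a linear combination of the vectors `tⁿ · x₀`, with coefficients of sum zero. -/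
lemma ProjectsTo.exists_sum_pow {t : EIso (Fin d₁ ⊕ Fin d₂)}
    {b : EuclideanSpace ℝ (Fin d₂)} (H : ProjectsTo t (translation b)) (z : Vec d₁ d₂) :
    ∃ (s : Finset ℕ) (c : ℕ → ℝ), ∑ n ∈ s, c n = 0 ∧
      ∑ n ∈ s, c n • (t ^ n) z = inrVec d₁ d₂ b := by
  -- The vectors `(t ^ n z - z) / n` lie in a finite-dimensional, hence closed, subspace and
  -- converge to `(0, b)`.
  have hmem : inrVec d₁ d₂ b ∈ vectorSpan ℝ (Set.range fun n : ℕ => (t ^ n) z) := by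
    have hcl := Submodule.closed_of_finiteDimensional
      (vectorSpan ℝ (Set.range fun n : ℕ => (t ^ n) z))
    have h0 : Tendsto (fun n : ℕ => (n : ℝ)⁻¹ • z) atTop (𝓝 0) := by
      simpa using (tendsto_inv_atTop_nhds_zero_nat (𝕜 := ℝ)).smul_const z
    have h1 := (H.tendsto_inv_smul_pow z).sub h0
    rw [sub_zero] at h1
    refine hcl.mem_of_tendsto h1 (Eventually.of_forall fun n => ?_)
    rw [← smul_sub]
    refine Submodule.smul_mem _ _ ?_
    exact vsub_mem_vectorSpan ℝ (Set.mem_range_self n) ⟨0, by simp⟩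
  rw [mem_vectorSpan_iff_eq_weightedVSub] at hmem
  obtain ⟨s, w, hw, h⟩ := hmem
  refine ⟨s, w, hw, ?_⟩
  rw [h, Finset.weightedVSub_eq_weightedVSubOfPoint_of_sum_eq_zero s w _ hw 0,
    Finset.weightedVSubOfPoint_apply]
  simp

end Projection

/-! ## Domination of seminorms on finite dimensional quotients -/

/-- `Q` factors through the range of `P`, which is finite dimensional, so the induced map is bounded
even though `E` is an arbitrary vector space. -/
lemma exists_bound_of_ker_le {E W W' : Type*} [AddCommGroup E] [Module ℝ E]
    [NormedAddCommGroup W] [NormedSpace ℝ W] [FiniteDimensional ℝ W]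
    [NormedAddCommGroup W'] [NormedSpace ℝ W'] (P : E →ₗ[ℝ] W) (Q : E →ₗ[ℝ] W')
    (h : ∀ x, P x = 0 → Q x = 0) : ∃ C : ℝ, 0 ≤ C ∧ ∀ x, ‖Q x‖ ≤ C * ‖P x‖ := by
  have hker : LinearMap.ker P ≤ LinearMap.ker Q := fun x hx => h x hx
  let Q' : LinearMap.range P →ₗ[ℝ] W' :=
    (P.ker.liftQ Q hker) ∘ₗ P.quotKerEquivRange.symm.toLinearMap
  have hQ' : ∀ x, Q x = LinearMap.toContinuousLinearMap Q' ⟨P x, x, rfl⟩ := by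
    intro x
    have : P.quotKerEquivRange.symm ⟨P x, x, rfl⟩ = P.ker.mkQ x := by
      rw [LinearEquiv.symm_apply_eq]
      rfl
    change _ = P.ker.liftQ Q hker (P.quotKerEquivRange.symm ⟨P x, x, rfl⟩)
    rw [this]
    rfl
  refine ⟨‖LinearMap.toContinuousLinearMap Q'‖, ContinuousLinearMap.opNorm_nonneg _, fun x => ?_⟩
  rw [hQ' x]
  exact (LinearMap.toContinuousLinearMap Q').le_opNorm _

/-- Two families are kept apart because they serve different roles below: `P` measures local
rigidity, `P'` the block that needs Korn's inequality. -/
lemma exists_bound_sq_of_ker_le {E W W' W'' κ κ' : Type*} [AddCommGroup E] [Module ℝ E]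
    [NormedAddCommGroup W] [NormedSpace ℝ W] [FiniteDimensional ℝ W]
    [NormedAddCommGroup W''] [NormedSpace ℝ W''] [FiniteDimensional ℝ W'']
    [NormedAddCommGroup W'] [NormedSpace ℝ W'] [Fintype κ] [Fintype κ']
    (P : κ → E →ₗ[ℝ] W) (P' : κ' → E →ₗ[ℝ] W'') (Q : E →ₗ[ℝ] W')
    (h : ∀ x, (∀ k, P k x = 0) → (∀ k, P' k x = 0) → Q x = 0) :
    ∃ C : ℝ, 0 ≤ C ∧ ∀ x, ‖Q x‖ ^ 2 ≤ C * (∑ k, ‖P k x‖ ^ 2 + ∑ k, ‖P' k x‖ ^ 2) := by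
  obtain ⟨C, hC, hb⟩ := exists_bound_of_ker_le
    ((LinearMap.pi P).prod (LinearMap.pi P')) Q (fun x hx => by
      have hx := Prod.mk.inj hx
      exact h x (fun k => congrFun hx.1 k) (fun k => congrFun hx.2 k))
  refine ⟨C ^ 2, by positivity, fun x => ?_⟩
  have h1 : ‖((LinearMap.pi P).prod (LinearMap.pi P')) x‖ ≤
      √(∑ k, ‖P k x‖ ^ 2 + ∑ k, ‖P' k x‖ ^ 2) := by
    refine max_le ?_ ?_ <;> refine (pi_norm_le_iff_of_nonneg (Real.sqrt_nonneg _)).2 fun k => ?_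
    · refine Real.le_sqrt_of_sq_le ?_
      have := Finset.single_le_sum (f := fun k => ‖P k x‖ ^ 2) (fun _ _ => by positivity)
        (Finset.mem_univ k)
      have h0 : 0 ≤ ∑ k, ‖P' k x‖ ^ 2 := by positivity
      exact this.trans (le_add_of_nonneg_right h0)
    · refine Real.le_sqrt_of_sq_le ?_
      have := Finset.single_le_sum (f := fun k => ‖P' k x‖ ^ 2) (fun _ _ => by positivity)
        (Finset.mem_univ k)
      have h0 : 0 ≤ ∑ k, ‖P k x‖ ^ 2 := by positivity
      exact this.trans (le_add_of_nonneg_left h0)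
  calc ‖Q x‖ ^ 2 ≤ (C * ‖((LinearMap.pi P).prod (LinearMap.pi P')) x‖) ^ 2 := by
        gcongr; exact hb x
    _ ≤ (C * √(∑ k, ‖P k x‖ ^ 2 + ∑ k, ‖P' k x‖ ^ 2)) ^ 2 := by gcongr
    _ = _ := by rw [mul_pow, Real.sq_sqrt (by positivity)]

/-! ## Korn's inequality for commuting permutations of a finite set -/

section Permutations

variable {X : Type*} [Fintype X]

/-- Summation by parts: substituting `(σ n)⁻¹ (τ m)⁻¹ x` for `x` moves each shift to the other
factor, inverted. -/
lemma sum_mul_sum_perm_comm {α β : Type*} (s : Finset α) (t : Finset β) (c : α → ℝ) (d : β → ℝ)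
    (σ : α → Equiv.Perm X) (τ : β → Equiv.Perm X) (hc : ∀ n m, Commute (σ n) (τ m))
    (f h : X → ℝ) :
    ∑ x, (∑ n ∈ s, c n * f (σ n x)) * (∑ m ∈ t, d m * h (τ m x)) =
      ∑ x, (∑ m ∈ t, d m * f ((τ m)⁻¹ x)) * (∑ n ∈ s, c n * h ((σ n)⁻¹ x)) := by
  have hterm : ∀ n m, ∑ x, f (σ n x) * h (τ m x) = ∑ x, f ((τ m)⁻¹ x) * h ((σ n)⁻¹ x) := by
    intro n m
    rw [← Equiv.sum_comp ((σ n)⁻¹ * (τ m)⁻¹) (fun x => f (σ n x) * h (τ m x))]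
    refine Finset.sum_congr rfl fun x _ => ?_
    congr 2
    · simp [Equiv.Perm.mul_apply]
    · rw [((hc n m).inv_inv).eq]
      simp [Equiv.Perm.mul_apply]
  simp only [Finset.sum_mul_sum]
  rw [Finset.sum_comm]
  conv_rhs => rw [Finset.sum_comm]; enter [2, m]; rw [Finset.sum_comm]
  conv_lhs => enter [2, n]; rw [Finset.sum_comm]
  rw [Finset.sum_comm]
  refine Finset.sum_congr rfl fun m _ => Finset.sum_congr rfl fun n _ => ?_
  have := congrArg (fun r => c n * d m * r) (hterm n m)
  simp only [Finset.mul_sum] at this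
  refine Eq.trans (Finset.sum_congr rfl fun x _ => by ring)
    (this.trans (Finset.sum_congr rfl fun x _ => by ring))

/-- With `D'` built from the inverse shifts, summation by parts gives `∑ D i j * D j i = ∑ D' j j *
D' i i` and `∑ (D i i)² = ∑ (D' i i)²`. Expanding `(D i j + D j i)²` and using `(D' j j + D' i i)² ≥
0` bounds the mixed term by the diagonal ones, which are already symmetric. No constant depends on
`X`. -/
lemma korn_perm {ι : Type*} (σ : ι → Equiv.Perm X) (hc : ∀ i j, Commute (σ i) (σ j))
    (s : ι → Finset ℕ) (c : ι → ℕ → ℝ) (f : ι → X → ℝ) (i j : ι) :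
    let D : ι → ι → X → ℝ := fun i j x => ∑ n ∈ s i, c i n * f j ((σ i ^ n) x)
    ∑ x, D i j x ^ 2 ≤ ∑ x, (D i j x + D j i x) ^ 2 + ∑ x, (D i i x + D i i x) ^ 2 +
      ∑ x, (D j j x + D j j x) ^ 2 := by
  intro D
  have hcomm : ∀ i j n m, Commute (σ i ^ n) (σ j ^ m) := fun i j n m => (hc i j).pow_pow n m
  let D' : ι → ι → X → ℝ := fun i j x => ∑ n ∈ s i, c i n * f j ((σ i ^ n)⁻¹ x)
  have h1 : ∑ x, D i j x * D j i x = ∑ x, D' j j x * D' i i x :=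
    sum_mul_sum_perm_comm (s i) (s j) (c i) (c j) _ _ (hcomm i j) (f j) (f i)
  have h2 : ∀ i, ∑ x, D i i x * D i i x = ∑ x, D' i i x * D' i i x := fun i =>
    sum_mul_sum_perm_comm (s i) (s i) (c i) (c i) _ _ (hcomm i i) (f i) (f i)
  have h3 : 0 ≤ ∑ x, (D' j j x + D' i i x) ^ 2 := by positivity
  have h4 : 0 ≤ ∑ x, D j i x ^ 2 := by positivity
  have h5 : ∀ i, 0 ≤ ∑ x, D i i x * D i i x := fun i =>
    Finset.sum_nonneg fun x _ => mul_self_nonneg _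
  have e1 : ∑ x, (D i j x + D j i x) ^ 2 =
      ∑ x, D i j x ^ 2 + 2 * ∑ x, D i j x * D j i x + ∑ x, D j i x ^ 2 := by
    rw [Finset.mul_sum, ← Finset.sum_add_distrib, ← Finset.sum_add_distrib]
    exact Finset.sum_congr rfl fun x _ => by ring
  have e2 : ∀ i, ∑ x, (D i i x + D i i x) ^ 2 = 4 * ∑ x, D i i x * D i i x := by
    intro i
    rw [Finset.mul_sum]
    exact Finset.sum_congr rfl fun x _ => by ring
  have e3 : ∑ x, (D' j j x + D' i i x) ^ 2 = ∑ x, D' j j x * D' j j x +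
      2 * ∑ x, D' j j x * D' i i x + ∑ x, D' i i x * D' i i x := by
    rw [Finset.mul_sum, ← Finset.sum_add_distrib, ← Finset.sum_add_distrib]
    exact Finset.sum_congr rfl fun x _ => by ring
  rw [e1, e2, e2]
  rw [e3, ← h1, ← h2, ← h2] at h3
  linarith [h5 i, h5 j]

end Permutations

/-! ## Infinitesimally rigid maps -/

section RigidMaps

variable {d₁ d₂ : ℕ} {G : Subgroup (EIso (Fin d₁ ⊕ Fin d₂))}

/-- The restriction of `w` to `R` is an infinitesimal rigid motion, with rotation part in `K`. -/
def IsRigidOn (x₀ : Vec d₁ d₂) (K : Submodule ℝ (Matrix (Fin d₁ ⊕ Fin d₂) (Fin d₁ ⊕ Fin d₂) ℝ))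
    (R : Set G) (w : G → Vec d₁ d₂) : Prop :=
  ∃ a, ∃ S ∈ K, ∀ h ∈ R, rot (h : EIso (Fin d₁ ⊕ Fin d₂)) (w h) =
    a + Matrix.toEuclideanLin S ((h : EIso (Fin d₁ ⊕ Fin d₂)) x₀ - x₀)

/-- On `k R`, the map `w` is the infinitesimal rigid motion `x ↦ c + S x`. -/
def AgreesOn (x₀ : Vec d₁ d₂) (R : Set G) (w : G → Vec d₁ d₂) (c : Vec d₁ d₂)
    (S : Matrix (Fin d₁ ⊕ Fin d₂) (Fin d₁ ⊕ Fin d₂) ℝ) (k : G) : Prop :=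
  ∀ h ∈ R, rot ((k * h : G) : EIso (Fin d₁ ⊕ Fin d₂)) (w (k * h)) =
    c + Matrix.toEuclideanLin S (((k * h : G) : EIso (Fin d₁ ⊕ Fin d₂)) x₀)

variable {x₀ : Vec d₁ d₂}

/-- Conjugating by `rot k` expresses the motion in a frame common to all `k`, so that the motions
found at different points can be compared. -/
lemma IsRigidOn.exists_agreesOn {R : Set G} {w : G → Vec d₁ d₂} {k : G}
    (H : IsRigidOn x₀ (skew _) R fun h => w (k * h)) :
    ∃ c, ∃ S ∈ skew (Fin d₁ ⊕ Fin d₂), AgreesOn x₀ R w c S k := by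
  obtain ⟨a, S, hS, h⟩ := H
  let ρ := rot (k : EIso (Fin d₁ ⊕ Fin d₂))
  refine ⟨ρ a - Matrix.toEuclideanLin (conj ρ S) ((k : EIso (Fin d₁ ⊕ Fin d₂)) x₀), conj ρ S,
    conj_mem_skew _ hS, fun r hr => ?_⟩
  rw [Subgroup.coe_mul, rot_mul, h r hr, map_add, sub_add, ← map_sub, toEuclideanLin_conj,
    AffineIsometryEquiv.coe_mul, Function.comp_apply, ← rot_apply_sub, LinearIsometryEquiv.symm_apply_apply,
    ← neg_sub x₀, map_neg, map_neg, sub_eq_add_neg]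
  exact (sub_eq_add_neg _ _).symm

lemma AgreesOn.isRigidOn {K : Submodule ℝ (Matrix (Fin d₁ ⊕ Fin d₂) (Fin d₁ ⊕ Fin d₂) ℝ)}
    {R : Set G} {w : G → Vec d₁ d₂} {k : G} {c : Vec d₁ d₂}
    {S : Matrix (Fin d₁ ⊕ Fin d₂) (Fin d₁ ⊕ Fin d₂) ℝ} (H : AgreesOn x₀ R w c S k)
    (hS : conj (rot (k : EIso (Fin d₁ ⊕ Fin d₂))).symm S ∈ K) :
    IsRigidOn x₀ K R fun h => w (k * h) := by
  let ρ := rot (k : EIso (Fin d₁ ⊕ Fin d₂))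
  refine ⟨ρ.symm (c + Matrix.toEuclideanLin S ((k : EIso (Fin d₁ ⊕ Fin d₂)) x₀)), _, hS,
    fun r hr => ?_⟩
  have := H r hr
  rw [Subgroup.coe_mul, rot_mul] at this
  rw [toEuclideanLin_conj, ← map_add, LinearIsometryEquiv.symm_symm, rot_apply_sub,
    ← (rot (k : EIso (Fin d₁ ⊕ Fin d₂))).symm_apply_apply (rot (r : EIso (Fin d₁ ⊕ Fin d₂)) _), this,
    add_assoc, ← map_add, add_sub_cancel]
  rfl

/-- Two infinitesimal rigid motions which agree on `k R · x₀` agree on `G · x₀`, if the affine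
hull of `R · x₀` is that of `G · x₀`. -/
lemma affine_eq_of_property1 {R : Set G} (hR : Property1 x₀ R) (k : G) {c c' : Vec d₁ d₂}
    {L L' : Vec d₁ d₂ →ₗ[ℝ] Vec d₁ d₂}
    (H : ∀ h ∈ R, c + L (((k * h : G) : EIso (Fin d₁ ⊕ Fin d₂)) x₀) =
      c' + L' (((k * h : G) : EIso (Fin d₁ ⊕ Fin d₂)) x₀)) (g : G) :
    c + L ((g : EIso (Fin d₁ ⊕ Fin d₂)) x₀) = c' + L' ((g : EIso (Fin d₁ ⊕ Fin d₂)) x₀) := by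
  let F : Vec d₁ d₂ →ᵃ[ℝ] Vec d₁ d₂ := (AffineMap.const ℝ _ c + L.toAffineMap).comp
    (k : EIso (Fin d₁ ⊕ Fin d₂)).toAffineEquiv.toAffineMap
  let F' : Vec d₁ d₂ →ᵃ[ℝ] Vec d₁ d₂ := (AffineMap.const ℝ _ c' + L'.toAffineMap).comp
    (k : EIso (Fin d₁ ⊕ Fin d₂)).toAffineEquiv.toAffineMap
  have h1 : Set.EqOn F F' (orbitSet x₀ R) := by
    rintro _ ⟨h, hh, rfl⟩
    exact H h hh
  have h2 : Set.EqOn F F' (affineSpan ℝ (orbitSet x₀ R)) := by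
    intro x hx
    refine affineSpan_induction (p := fun x => F x = F' x) hx (fun x hx => h1 hx)
      fun a x y z hx hy hz => ?_
    simp only [AffineMap.map_vadd, map_smul, AffineMap.linearMap_vsub, hx, hy, hz]
  rw [hR.2.2] at h2
  have h3 := h2 (subset_affineSpan ℝ _ ⟨k⁻¹ * g, Set.mem_univ _, rfl⟩)
  have h4 : (k : EIso (Fin d₁ ⊕ Fin d₂)) (((k⁻¹ * g : G) : EIso (Fin d₁ ⊕ Fin d₂)) x₀) =
      (g : EIso (Fin d₁ ⊕ Fin d₂)) x₀ := by
    rw [← Function.comp_apply (f := (k : EIso (Fin d₁ ⊕ Fin d₂))), ← AffineIsometryEquiv.coe_mul,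
      ← Subgroup.coe_mul, mul_inv_cancel_left]
  change c + L ((k : EIso (Fin d₁ ⊕ Fin d₂)) _) = c' + L' ((k : EIso (Fin d₁ ⊕ Fin d₂)) _) at h3
  rwa [h4] at h3

lemma Property2.one_mem {R : Set G} (hR : Property2 x₀ R) : (1 : G) ∈ R := by
  obtain ⟨-, R', R'', h1, -, hR'', hsub⟩ := hR
  exact hsub ⟨1, h1, 1, hR''.2.1, mul_one 1⟩

/-- Local rigidity near finitely many points forces the rigid motions at `1` and at `r` to be the
same. -/
lemma exists_finset_agreesOn {R : Set G} (hR : Property2 x₀ R) (r : G) :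
    ∃ K : Finset G, ∀ w : G → Vec d₁ d₂,
      (∀ k ∈ K, IsRigidOn x₀ (skew _) R fun h => w (k * h)) →
        ∀ c S, AgreesOn x₀ R w c S 1 → AgreesOn x₀ R w c S r := by
  classical
  obtain ⟨-, R', R'', h1, hgen, hR'', hsub⟩ := hR
  have hr : r ∈ Subgroup.closure R' := hgen ▸ Subgroup.mem_top r
  have hsub1 : R'' ⊆ R := fun h hh => hsub ⟨1, h1, h, hh, one_mul h⟩
  -- The two motions agree on `p R'' • x₀`, since `p R''` lies in both `k R` and `k' R`; by Property
  -- 1 they then agree on the whole orbit. Their matrices may still differ if the orbit does not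
  -- span, so the pair `(c, S)` itself is carried along.
  have transfer : ∀ (w : G → Vec d₁ d₂) c S c' S' (k k' p : G), AgreesOn x₀ R w c S k →
      AgreesOn x₀ R w c' S' k' → (∀ h ∈ R'', k⁻¹ * (p * h) ∈ R) →
      (∀ h ∈ R'', k'⁻¹ * (p * h) ∈ R) → AgreesOn x₀ R w c S k' := by
    intro w c S c' S' k k' p hk hk' hp hp' h hh
    rw [hk' h hh]
    refine (affine_eq_of_property1 hR'' p (fun q hq => ?_) (k' * h)).symm
    have e1 := hk _ (hp q hq)
    have e2 := hk' _ (hp' q hq)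
    rw [mul_inv_cancel_left] at e1 e2
    exact e1.symm.trans e2
  induction hr using Subgroup.closure_induction_right with
  | one => exact ⟨∅, fun w _ c S h => h⟩
  | mul_right x hx s hs ih =>
    obtain ⟨K, hK⟩ := ih
    refine ⟨insert (x * s) K, fun w hw c S h => ?_⟩
    obtain ⟨c', S', -, h'⟩ := (hw _ (Finset.mem_insert_self _ _)).exists_agreesOn
    have hx := hK w (fun k hk => hw k (Finset.mem_insert_of_mem hk)) c S h
    -- Overlap `x s R''`: it lies in `x R` by `R' R'' ⊆ R`, and in `x s R` by `R'' ⊆ R`.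
    refine transfer w c S c' S' x (x * s) (x * s) hx h' (fun q hq => ?_) (fun q hq => ?_)
    · rw [mul_assoc, inv_mul_cancel_left]
      exact hsub ⟨s, hs, q, hq, rfl⟩
    · rw [inv_mul_cancel_left]
      exact hsub1 hq
  | mul_inv_cancel x hx s hs ih =>
    obtain ⟨K, hK⟩ := ih
    refine ⟨insert (x * s⁻¹) K, fun w hw c S h => ?_⟩
    obtain ⟨c', S', -, h'⟩ := (hw _ (Finset.mem_insert_self _ _)).exists_agreesOn
    have hx := hK w (fun k hk => hw k (Finset.mem_insert_of_mem hk)) c S h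
    -- Overlap `x R''`, which equals `(x s⁻¹) s R''`.
    refine transfer w c S c' S' x (x * s⁻¹) x hx h' (fun q hq => ?_) (fun q hq => ?_)
    · rw [inv_mul_cancel_left]
      exact hsub1 hq
    · rw [mul_inv_rev, inv_inv, mul_assoc, inv_mul_cancel_left]
      exact hsub ⟨s, hs, q, hq, rfl⟩

/-- Local rigidity near the points of a suitable finite set implies rigidity on a given finite
set. -/
lemma exists_finset_isRigidOn {R : Set G} (hR : Property2 x₀ R) (Q : Finset G) :
    ∃ K : Finset G, ∀ w : G → Vec d₁ d₂,
      (∀ k ∈ K, IsRigidOn x₀ (skew _) R fun h => w (k * h)) →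
        IsRigidOn x₀ (skew _) (Q : Set G) w := by
  classical
  choose K hK using exists_finset_agreesOn hR
  refine ⟨insert 1 (Q.biUnion K), fun w hw => ?_⟩
  obtain ⟨c, S, hS, h⟩ := (hw 1 (Finset.mem_insert_self _ _)).exists_agreesOn
  refine ⟨c + Matrix.toEuclideanLin S x₀, S, hS, fun r hr => ?_⟩
  have := hK r w (fun k hk => hw k (Finset.mem_insert_of_mem
    (Finset.mem_biUnion.2 ⟨r, hr, hk⟩))) c S h 1 hR.one_mem
  rw [mul_one] at this
  rw [this, map_sub, add_assoc, add_sub_cancel]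

end RigidMaps

/-! ## The translation sections `T ^ N` -/

section Sections

variable {d₁ d₂ : ℕ} {G : Subgroup (EIso (Fin d₁ ⊕ Fin d₂))} {S : Subgroup (EIso (Fin d₂))}
  {T : Set G}

lemma IsTranslationSection.exists_mem_projectsTo (hT : IsTranslationSection S T) {N : ℕ}
    {H : Subgroup G} (hH : (H : Set G) = powSet T N) {z : EuclideanSpace ℝ (Fin d₂)}
    (hz : translation z ∈ S) :
    ∃ t ∈ H, ProjectsTo (t : EIso (Fin d₁ ⊕ Fin d₂)) (translation ((N : ℝ) • z)) := by
  obtain ⟨t, ⟨htT, ht⟩, -⟩ := hT.2 z hz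
  refine ⟨t ^ N, ?_, ?_⟩
  · rw [← SetLike.mem_coe, hH]
    exact ⟨t, htT, rfl⟩
  · rw [← translation_pow]
    exact ht.pow N

/-- `s t` and `t s` lie in `T ^ N` over the same translation. Its vector has a unique `N`-th part
`z`, and `T` has a unique element over `z`; both products are the `N`-th power of that element. -/
lemma IsTranslationSection.commute (hT : IsTranslationSection S T) {N : ℕ} (hN : 1 ≤ N)
    {H : Subgroup G} (hH : (H : Set G) = powSet T N) {s t : G} (hs : s ∈ H) (ht : t ∈ H) :
    Commute s t := by
  have lift : ∀ r ∈ H, ∃ v, translation v ∈ S ∧ ∃ ρ ∈ T, r = ρ ^ N ∧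
      ProjectsTo (ρ : EIso (Fin d₁ ⊕ Fin d₂)) (translation v) ∧
      ProjectsTo (r : EIso (Fin d₁ ⊕ Fin d₂)) (translation ((N : ℝ) • v)) := by
    intro r hr
    rw [← SetLike.mem_coe, hH] at hr
    obtain ⟨ρ, hρ, rfl⟩ := hr
    obtain ⟨v, hv, hρv⟩ := hT.1 ρ hρ
    exact ⟨v, hv, ρ, hρ, rfl, hρv, by rw [← translation_pow]; exact hρv.pow N⟩
  obtain ⟨v, -, -, -, -, -, hv⟩ := lift s hs
  obtain ⟨w, -, -, -, -, -, hw⟩ := lift t ht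
  obtain ⟨z, hzS, ρ, hρ, hρe, hρz, hz⟩ := lift (s * t) (mul_mem hs ht)
  obtain ⟨z', -, ρ', hρ', hρe', hρz', hz'⟩ := lift (t * s) (mul_mem ht hs)
  have e1 := translation_injective ((hv.mul hw).unique hz ▸ translation_mul _ _)
  have e2 := translation_injective ((hw.mul hv).unique hz' ▸ translation_mul _ _)
  have hN' : (N : ℝ) ≠ 0 := by positivity
  have e3 : z = z' := smul_right_injective _ hN' (by
    change (N : ℝ) • z = (N : ℝ) • z'
    rw [e1, e2, add_comm])
  subst e3
  have e4 : ρ = ρ' := (hT.2 z hzS).unique ⟨hρ, hρz⟩ ⟨hρ', hρz'⟩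
  change s * t = t * s
  rw [hρe, hρe', e4]

lemma exists_basis_translation (hS : IsSpaceGroup S) :
    ∃ b : Module.Basis (Fin d₂) ℝ (EuclideanSpace ℝ (Fin d₂)), ∀ i, translation (b i) ∈ S := by
  obtain ⟨-, v, hv, hvS⟩ := hS
  refine ⟨basisOfLinearIndependentOfCardEqFinrank' v hv (by simp), fun i => ?_⟩
  rw [coe_basisOfLinearIndependentOfCardEqFinrank']
  exact hvS i

lemma translation_mem_of_mem_span {b : Fin d₂ → EuclideanSpace ℝ (Fin d₂)}
    (hb : ∀ i, translation (b i) ∈ S) {z : EuclideanSpace ℝ (Fin d₂)}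
    (hz : z ∈ Submodule.span ℤ (Set.range b)) : translation z ∈ S := by
  rw [← Submodule.mem_toAddSubgroup, Submodule.span_int_eq_addSubgroupClosure] at hz
  induction hz using AddSubgroup.closure_induction with
  | mem x hx => obtain ⟨i, rfl⟩ := hx; exact hb i
  | zero => rw [translation_zero]; exact one_mem S
  | add x y _ _ hx hy => rw [← translation_mul]; exact mul_mem hx hy
  | neg x _ hx =>
    have : translation (-x) = (translation x)⁻¹ := by
      rw [eq_inv_iff_mul_eq_one, translation_mul, neg_add_cancel, translation_zero]
    rw [this]
    exact inv_mem hx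

lemma exists_commuting_lifts (hS : IsSpaceGroup S) (hT : IsTranslationSection S T)
    (hadm : (admissible T).Nonempty) :
    ∃ (b : Module.Basis (Fin d₂) ℝ (EuclideanSpace ℝ (Fin d₂))) (a : Fin d₂ → G),
      (∀ i, ProjectsTo (a i : EIso (Fin d₁ ⊕ Fin d₂)) (translation (b i))) ∧
        ∀ i j, Commute (a i) (a j) := by
  obtain ⟨N, hN, H, -, hH⟩ := hadm
  obtain ⟨b, hb⟩ := exists_basis_translation hS
  choose a ha hab using fun i => hT.exists_mem_projectsTo hH (hb i)
  have hN' : (N : ℝ) ≠ 0 := by positivity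
  -- The lifts in `T ^ N` lie over `N b i`, so the basis is rescaled by `N`.
  refine ⟨b.unitsSMul fun _ => Units.mk0 (N : ℝ) hN', a, fun i => ?_,
    fun i j => hT.commute hN hH (ha i) (ha j)⟩
  rw [Module.Basis.unitsSMul_apply]
  exact hab i

/-- Discreteness isolates `x₀` in its orbit, and since `G` acts by isometries the same `ε` separates
all orbit points. A ball is covered by finitely many `ε / 2`-balls, each containing at most one
orbit point, and the orbit map is injective. -/
lemma finite_setOf_norm_le (hG : IsDiscreteGroup G) {x₀ : Vec d₁ d₂}
    (hx₀ : Function.Injective fun g : G => (g : EIso (Fin d₁ ⊕ Fin d₂)) x₀) (M : ℝ) :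
    {g : G | ‖(g : EIso (Fin d₁ ⊕ Fin d₂)) x₀‖ ≤ M}.Finite := by
  obtain ⟨ε, hε, hsep⟩ : ∃ ε > 0, ∀ g : G, dist ((g : EIso (Fin d₁ ⊕ Fin d₂)) x₀) x₀ < ε →
      g = 1 := by
    have hd := (hG x₀).to_subtype
    have h1 : x₀ ∈ Set.range fun g : G => (g : EIso (Fin d₁ ⊕ Fin d₂)) x₀ := ⟨1, rfl⟩
    obtain ⟨ε, hε, h⟩ := Metric.isOpen_singleton_iff.1 (isOpen_discrete
      ({⟨x₀, h1⟩} : Set (Set.range fun g : G => (g : EIso (Fin d₁ ⊕ Fin d₂)) x₀)))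
    refine ⟨ε, hε, fun g hg => hx₀ ?_⟩
    exact congrArg Subtype.val (h ⟨_, g, rfl⟩ hg)
  obtain ⟨t, ht, hcov⟩ := Metric.totallyBounded_iff.1
    (isCompact_closedBall (0 : Vec d₁ d₂) M).totallyBounded (ε / 2) (half_pos hε)
  have hy : ∀ g : {g : G | ‖(g : EIso (Fin d₁ ⊕ Fin d₂)) x₀‖ ≤ M}, ∃ y : t,
      dist (((g : G) : EIso (Fin d₁ ⊕ Fin d₂)) x₀) y < ε / 2 := by
    intro g
    have hg := hcov (mem_closedBall_zero_iff.2 g.2)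
    simp only [Set.mem_iUnion, Metric.mem_ball] at hg
    obtain ⟨y, hy, h⟩ := hg
    exact ⟨⟨y, hy⟩, h⟩
  choose y hy using hy
  have := ht.to_subtype
  refine Set.finite_coe_iff.1 (Finite.of_injective y fun g g' hgg' => ?_)
  have h1 : dist (((g : G) : EIso (Fin d₁ ⊕ Fin d₂)) x₀)
      (((g' : G) : EIso (Fin d₁ ⊕ Fin d₂)) x₀) < ε := by
    have h2 := hy g'
    rw [← hgg'] at h2
    linarith [dist_triangle_right (((g : G) : EIso (Fin d₁ ⊕ Fin d₂)) x₀)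
      (((g' : G) : EIso (Fin d₁ ⊕ Fin d₂)) x₀) (y g), hy g]
  have h3 : (((g' : G) : EIso (Fin d₁ ⊕ Fin d₂)))
      ((((g' : G)⁻¹ * (g : G) : G) : EIso (Fin d₁ ⊕ Fin d₂)) x₀) =
      ((g : G) : EIso (Fin d₁ ⊕ Fin d₂)) x₀ := by
    rw [← Function.comp_apply (f := ((g' : G) : EIso (Fin d₁ ⊕ Fin d₂))),
      ← AffineIsometryEquiv.coe_mul, ← Subgroup.coe_mul, mul_inv_cancel_left]
  rw [← h3, AffineIsometryEquiv.dist_map] at h1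
  exact Subtype.ext (inv_mul_eq_one.1 (hsep _ h1)).symm

/-- Every coset has a representative `g` with `g x₀` in a fixed ball: a lift in `T ^ N` moves the
second component into `N` times a fundamental parallelepiped, and the first component keeps its
norm. -/
lemma finite_quotient (hG : IsDiscreteGroup G) (hS : IsSpaceGroup S)
    (hGS : ∀ g ∈ G, ∃ h ∈ S, ProjectsTo g h) (hT : IsTranslationSection S T) {x₀ : Vec d₁ d₂}
    (hx₀ : Function.Injective fun g : G => (g : EIso (Fin d₁ ⊕ Fin d₂)) x₀) {N : ℕ}
    (hN : 1 ≤ N) {H : Subgroup G} [H.Normal] (hH : (H : Set G) = powSet T N) :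
    Finite (G ⧸ H) := by
  obtain ⟨b, hb⟩ := exists_basis_translation hS
  obtain ⟨x₁, y₁, hx₁⟩ := exists_eq_joinVec x₀
  let M : ℝ := ‖x₁‖ + N * ∑ i, ‖b i‖
  have := (finite_setOf_norm_le hG hx₀ M).to_subtype
  refine Finite.of_surjective
    (fun g : {g : G | ‖(g : EIso (Fin d₁ ⊕ Fin d₂)) x₀‖ ≤ M} => ((g : G) : G ⧸ H)) fun q => ?_
  obtain ⟨g, rfl⟩ := QuotientGroup.mk_surjective q
  obtain ⟨h, -, A, hA⟩ := hGS g g.2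
  have hN' : (N : ℝ) ≠ 0 := by positivity
  let z : EuclideanSpace ℝ (Fin d₂) := ZSpan.floor b ((N : ℝ)⁻¹ • h y₁)
  have hz : translation (-z) ∈ S :=
    translation_mem_of_mem_span hb (neg_mem (ZSpan.floor b ((N : ℝ)⁻¹ • h y₁)).2)
  obtain ⟨t, ht, B, hB⟩ := hT.exists_mem_projectsTo hH hz
  have hval : ((t * g : G) : EIso (Fin d₁ ⊕ Fin d₂)) x₀ =
      joinVec (B (A x₁)) ((N : ℝ) • ZSpan.fract b ((N : ℝ)⁻¹ • h y₁)) := by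
    rw [hx₁, Subgroup.coe_mul, AffineIsometryEquiv.coe_mul, Function.comp_apply, hA, hB]
    congr 1
    rw [ZSpan.fract_apply, smul_sub, smul_inv_smul₀ hN']
    simp [translation, z, sub_eq_neg_add]
  refine ⟨⟨t * g, ?_⟩, ?_⟩
  · change ‖((t * g : G) : EIso (Fin d₁ ⊕ Fin d₂)) x₀‖ ≤ M
    rw [hval]
    have hf := ZSpan.norm_fract_le b ((N : ℝ)⁻¹ • h y₁)
    have h0 : 0 ≤ ∑ i, ‖b i‖ := by positivity
    refine abs_le_of_sq_le_sq' ?_ (by positivity) |>.2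
    rw [norm_joinVec_sq, norm_smul, Real.norm_natCast, LinearIsometryEquiv.norm_map,
      LinearIsometryEquiv.norm_map]
    have h1 : (N : ℝ) * ‖ZSpan.fract b ((N : ℝ)⁻¹ • h y₁)‖ ≤ N * ∑ i, ‖b i‖ := by gcongr
    have h2 : ((N : ℝ) * ‖ZSpan.fract b ((N : ℝ)⁻¹ • h y₁)‖) ^ 2 ≤ (N * ∑ i, ‖b i‖) ^ 2 := by
      gcongr
    have h3 : 0 ≤ ‖x₁‖ * (N * ∑ i, ‖b i‖) := by positivity
    nlinarith
  · change ((t * g : G) : G ⧸ H) = g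
    rw [QuotientGroup.mk_mul, (QuotientGroup.eq_one_iff t).2 ht, one_mul]

/-- A periodic function factors through a finite quotient group of `G`, and averages are averages
over this quotient. -/
lemma exists_finite_quotient (hG : IsDiscreteGroup G) (hS : IsSpaceGroup S)
    (hGS : ∀ g ∈ G, ∃ h ∈ S, ProjectsTo g h) (hT : IsTranslationSection S T) {x₀ : Vec d₁ d₂}
    (hx₀ : Function.Injective fun g : G => (g : EIso (Fin d₁ ⊕ Fin d₂)) x₀)
    {C : ℕ → Set G} (hC : IsRepresentationFamily T C) {u : G → Vec d₁ d₂} (hu : u ∈ Uper T) :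
    ∃ (Q : Type) (_ : Group Q) (_ : Fintype Q) (φ : G →* Q) (f : Q → Vec d₁ d₂),
      Function.Surjective φ ∧ (∀ g, u g = f (φ g)) ∧
      ∀ (F : G → ℝ) (F' : Q → ℝ), (∀ g, F' (φ g) = F g) →
        average (C (period T u)) F = (1 / (Fintype.card Q : ℝ)) * ∑ q, F' q := by
  obtain ⟨hadm, hper⟩ := period_spec hu
  have hCN := hC _ hadm
  obtain ⟨hN, H, hnormal, hH⟩ := hadm
  have hfin := finite_quotient hG hS hGS hT hx₀ hN hH
  rw [← hH] at hCN
  let _ : Fintype (G ⧸ H) := Fintype.ofFinite _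
  refine ⟨G ⧸ H, inferInstance, inferInstance, QuotientGroup.mk' H,
    fun q => Quotient.liftOn' q u ?_, QuotientGroup.mk'_surjective H, fun g => rfl, ?_⟩
  · intro a b hab
    have := hper a (a⁻¹ * b) (hH ▸ QuotientGroup.leftRel_apply.mp hab)
    rwa [mul_inv_cancel_left] at this
  · intro F F' hF
    rw [average_eq_quotient hCN F F' hF, Nat.card_eq_fintype_card, finsum_eq_sum_of_fintype]

end Sections

/-! ## The seminorms as averages of local seminorms -/

section LocalSeminorms

variable {d₁ d₂ : ℕ} {G : Subgroup (EIso (Fin d₁ ⊕ Fin d₂))} {x₀ : Vec d₁ d₂}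

/-- The seminorm on periodic functions obtained by averaging the local seminorm `w ↦ ‖Λ w‖`. -/
def averageNorm {W : Type} [NormedAddCommGroup W] [NormedSpace ℝ W] (T : Set G) (C : ℕ → Set G)
    (Λ : (G → Vec d₁ d₂) →ₗ[ℝ] W) (u : G → Vec d₁ d₂) : ℝ :=
  √(average (C (period T u)) fun g => ‖Λ fun h => u (g * h)‖ ^ 2)

/-- The kernel of `Λ` lies between the infinitesimal rigid motions on `R` with rotation part in
`skewZero` and those with arbitrary rotation part. -/
def DetectsRigidity {W : Type} [AddCommGroup W] [Module ℝ W] (x₀ : Vec d₁ d₂) (R : Set G)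
    (Λ : (G → Vec d₁ d₂) →ₗ[ℝ] W) : Prop :=
  (∀ w, IsRigidOn x₀ (skewZero d₁ d₂) R w → Λ w = 0) ∧
    ∀ w, Λ w = 0 → IsRigidOn x₀ (skew (Fin d₁ ⊕ Fin d₂)) R w

lemma IsRigidOn.mono {K K' : Submodule ℝ (Matrix (Fin d₁ ⊕ Fin d₂) (Fin d₁ ⊕ Fin d₂) ℝ)}
    {R R' : Set G} {w : G → Vec d₁ d₂} (H : IsRigidOn x₀ K R w) (hK : K ≤ K') (hR : R' ⊆ R) :
    IsRigidOn x₀ K' R' w := by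
  obtain ⟨a, S, hS, h⟩ := H
  exact ⟨a, S, hK hS, fun r hr => h r (hR hr)⟩

/-- The orthogonal projection with kernel `U`, whose norm is `projNorm`. -/
def projMap {R : Finset G} (U : Submodule ℝ (R → Vec d₁ d₂)) :
    (R → Vec d₁ d₂) →ₗ[ℝ] PiLp 2 fun _ : R => Vec d₁ d₂ :=
  ((U.comap (WithLp.linearEquiv 2 ℝ (R → Vec d₁ d₂)).toLinearMap)ᗮ).starProjection.toLinearMap ∘ₗ
    (WithLp.linearEquiv 2 ℝ (R → Vec d₁ d₂)).symm.toLinearMap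

lemma projMap_eq_zero_iff {R : Finset G} {U : Submodule ℝ (R → Vec d₁ d₂)} {w : R → Vec d₁ d₂} :
    projMap U w = 0 ↔ w ∈ U := by
  change Submodule.starProjection _ _ = 0 ↔ _
  rw [Submodule.starProjection_apply_eq_zero_iff, Submodule.orthogonal_orthogonal]
  rfl

/-- The discrete derivative at the identity. -/
def derivMap (R : Finset G) : (G → Vec d₁ d₂) →ₗ[ℝ] (R → Vec d₁ d₂) where
  toFun w h := w h - (rot (h : EIso (Fin d₁ ⊕ Fin d₂))).symm (w 1)
  map_add' w w' := by
    ext1 h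
    simp only [Pi.add_apply, map_add]
    abel
  map_smul' c w := by
    ext1 h
    simp only [Pi.smul_apply, map_smul, RingHom.id_apply, smul_sub]

lemma restrict_mem_Uiso_iff
    {K : Submodule ℝ (Matrix (Fin d₁ ⊕ Fin d₂) (Fin d₁ ⊕ Fin d₂) ℝ)} {R : Set G}
    {w : G → Vec d₁ d₂} : (fun h : R => w h) ∈ Uiso x₀ K R ↔ IsRigidOn x₀ K R w := by
  rw [Uiso, Submodule.mem_sup]
  constructor
  · rintro ⟨u, ⟨a, ha⟩, v, ⟨S, hS, hv⟩, huv⟩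
    refine ⟨a, S, hS, fun h hh => ?_⟩
    have := congrFun huv ⟨h, hh⟩
    rw [← show (u + v) ⟨h, hh⟩ = w h from this, Pi.add_apply, map_add]
    exact congrArg₂ (· + ·) (ha ⟨h, hh⟩) (hv ⟨h, hh⟩)
  · rintro ⟨a, S, hS, h⟩
    refine ⟨fun r => (rot (r : EIso (Fin d₁ ⊕ Fin d₂))).symm a, ⟨a, fun r => by simp⟩,
      fun r => (rot (r : EIso (Fin d₁ ⊕ Fin d₂))).symm
        (Matrix.toEuclideanLin S ((r : EIso (Fin d₁ ⊕ Fin d₂)) x₀ - x₀)),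
      ⟨S, hS, fun r => by rw [LinearIsometryEquiv.apply_symm_apply]⟩, ?_⟩
    ext1 r
    rw [Pi.add_apply, ← map_add, ← h r r.2, LinearIsometryEquiv.symm_apply_apply]

/-- At `h = 1` the rotation term vanishes, so the translation part of a rigid `w` must be `w 1`,
which is what the derivative subtracts. -/
lemma derivMap_mem_Urot_iff
    {K : Submodule ℝ (Matrix (Fin d₁ ⊕ Fin d₂) (Fin d₁ ⊕ Fin d₂) ℝ)} {R : Finset G}
    (h1 : 1 ∈ R) {w : G → Vec d₁ d₂} :
    derivMap R w ∈ Urot x₀ K (R : Set G) ↔ IsRigidOn x₀ K (R : Set G) w := by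
  have key : ∀ h : R, rot (h : EIso (Fin d₁ ⊕ Fin d₂)) (derivMap R w h) =
      rot (h : EIso (Fin d₁ ⊕ Fin d₂)) (w h) - w 1 := fun h => by
    change rot (h : EIso (Fin d₁ ⊕ Fin d₂)) (_ - _) = _
    rw [map_sub, LinearIsometryEquiv.apply_symm_apply]
  constructor
  · rintro ⟨S, hS, h⟩
    refine ⟨w 1, S, hS, fun r hr => ?_⟩
    have := h ⟨r, hr⟩
    rw [key ⟨r, hr⟩] at this
    rw [← this, add_sub_cancel]
  · rintro ⟨a, S, hS, h⟩
    have ha : w 1 = a := by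
      have := h 1 h1
      rw [OneMemClass.coe_one, AffineIsometryEquiv.coe_one, id, sub_self, map_zero, add_zero] at this
      exact this
    refine ⟨S, hS, fun r => ?_⟩
    rw [key r, h r r.2, ha, add_sub_cancel_left]

/-- Both matrix spaces lie between `skewZero` and `skew`, and the projections vanish exactly on the
rigid motions of their class. -/
lemma exists_averageNorm_of_mem_eightSeminorms {T : Set G} {C : ℕ → Set G} {R₁ R₂ : Finset G}
    (hR₁ : Property2 x₀ (R₁ : Set G)) (hR₂ : Property2 x₀ (R₂ : Set G))
    {p : (G → Vec d₁ d₂) → ℝ} (hp : p ∈ eightSeminorms T C x₀ R₁ R₂) :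
    ∃ R : Finset G, Property2 x₀ (R : Set G) ∧
      ∃ Λ : (G → Vec d₁ d₂) →ₗ[ℝ] PiLp 2 fun _ : R => Vec d₁ d₂,
        DetectsRigidity x₀ (R : Set G) Λ ∧ p = averageNorm T C Λ := by
  have hr : ∀ K, skewZero d₁ d₂ ≤ K → K ≤ skew (Fin d₁ ⊕ Fin d₂) → ∀ R : Finset G,
      Property2 x₀ (R : Set G) → ∃ R' : Finset G, Property2 x₀ (R' : Set G) ∧
        ∃ Λ : (G → Vec d₁ d₂) →ₗ[ℝ] PiLp 2 fun _ : R' => Vec d₁ d₂,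
          DetectsRigidity x₀ (R' : Set G) Λ ∧ rigidityNorm T C x₀ K R = averageNorm T C Λ := by
    intro K hK hK' R hR
    have hΛ : ∀ w : G → Vec d₁ d₂, (projMap (R := R) (Uiso x₀ K (R : Set G)) ∘ₗ
        LinearMap.funLeft ℝ (Vec d₁ d₂) fun h : R => (h : G)) w = 0 ↔
        IsRigidOn x₀ K (R : Set G) w := fun w =>
      projMap_eq_zero_iff.trans restrict_mem_Uiso_iff
    exact ⟨R, hR, _, ⟨fun w hw => (hΛ w).2 (hw.mono hK subset_rfl),
      fun w hw => ((hΛ w).1 hw).mono hK' subset_rfl⟩, rfl⟩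
  have hg : ∀ K, skewZero d₁ d₂ ≤ K → K ≤ skew (Fin d₁ ⊕ Fin d₂) → ∀ R : Finset G,
      Property2 x₀ (R : Set G) → ∃ R' : Finset G, Property2 x₀ (R' : Set G) ∧
        ∃ Λ : (G → Vec d₁ d₂) →ₗ[ℝ] PiLp 2 fun _ : R' => Vec d₁ d₂,
          DetectsRigidity x₀ (R' : Set G) Λ ∧
            gradRigidityNorm T C x₀ K R = averageNorm T C Λ := by
    intro K hK hK' R hR
    have hΛ : ∀ w : G → Vec d₁ d₂, (projMap (R := R) (Urot x₀ K (R : Set G)) ∘ₗ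
        derivMap R) w = 0 ↔ IsRigidOn x₀ K (R : Set G) w := fun w =>
      projMap_eq_zero_iff.trans (derivMap_mem_Urot_iff hR.one_mem)
    refine ⟨R, hR, _, ⟨fun w hw => (hΛ w).2 (hw.mono hK subset_rfl),
      fun w hw => ((hΛ w).1 hw).mono hK' subset_rfl⟩, ?_⟩
    ext1 u
    have hd : ∀ g, discreteDeriv R u g = derivMap R fun h => u (g * h) := fun g => by
      ext1 h
      simp [discreteDeriv, derivMap]
    simp only [gradRigidityNorm, hd]
    rfl
  rcases hp with rfl | rfl | rfl | rfl | rfl | rfl | rfl | rfl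
  · exact hr _ skewZero_le_skew le_rfl _ hR₁
  · exact hr _ skewZero_le_skew le_rfl _ hR₂
  · exact hr _ le_rfl skewZero_le_skew _ hR₁
  · exact hr _ le_rfl skewZero_le_skew _ hR₂
  · exact hg _ skewZero_le_skew le_rfl _ hR₁
  · exact hg _ skewZero_le_skew le_rfl _ hR₂
  · exact hg _ le_rfl skewZero_le_skew _ hR₁
  · exact hg _ le_rfl skewZero_le_skew _ hR₂

end LocalSeminorms

/-! ## Korn's inequality -/

section Korn

variable {d₁ d₂ : ℕ} {G : Subgroup (EIso (Fin d₁ ⊕ Fin d₂))} {x₀ : Vec d₁ d₂}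

/-- The difference operator `w ↦ ∑ cₙ ⟨v, w(aⁿ)⟩`. -/
def diffOp (a : G) (s : Finset ℕ) (c : ℕ → ℝ) (v : Vec d₁ d₂) : (G → Vec d₁ d₂) →ₗ[ℝ] ℝ :=
  ∑ n ∈ s, c n • (innerₛₗ ℝ v ∘ₗ LinearMap.proj (a ^ n))

lemma diffOp_apply (a : G) (s : Finset ℕ) (c : ℕ → ℝ) (v : Vec d₁ d₂) (w : G → Vec d₁ d₂) :
    diffOp a s c v w = ∑ n ∈ s, c n * ⟪v, w (a ^ n)⟫ := by
  simp [diffOp]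

/-- On rigid motions, the difference operators extract the `d₂ × d₂` block of the rotation. -/
lemma diffOp_of_rigid {a : G} {b b' : EuclideanSpace ℝ (Fin d₂)}
    (ha : ProjectsTo (a : EIso (Fin d₁ ⊕ Fin d₂)) (translation b)) {s : Finset ℕ} {c : ℕ → ℝ}
    (hc : ∑ n ∈ s, c n = 0)
    (hcb : ∑ n ∈ s, c n • ((a : EIso (Fin d₁ ⊕ Fin d₂)) ^ n) x₀ = inrVec d₁ d₂ b)
    {w : G → Vec d₁ d₂} {v₀ : Vec d₁ d₂} {S : Matrix (Fin d₁ ⊕ Fin d₂) (Fin d₁ ⊕ Fin d₂) ℝ}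
    (hw : ∀ n ∈ s, rot ((a ^ n : G) : EIso (Fin d₁ ⊕ Fin d₂)) (w (a ^ n)) =
      v₀ + Matrix.toEuclideanLin S (((a ^ n : G) : EIso (Fin d₁ ⊕ Fin d₂)) x₀ - x₀)) :
    diffOp a s c (inrVec d₁ d₂ b') w =
      ⟪inrVec d₁ d₂ b', Matrix.toEuclideanLin S (inrVec d₁ d₂ b)⟫ := by
  -- `rot (a ^ n)` fixes `(0, b')`, so it can be inserted into the inner product. The part
  -- independent of `n` then drops out because the coefficients sum to zero.
  have h1 : ∀ n ∈ s, c n * ⟪inrVec d₁ d₂ b', w (a ^ n)⟫ = c n *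
      ⟪inrVec d₁ d₂ b', v₀ - Matrix.toEuclideanLin S x₀⟫ +
      ⟪inrVec d₁ d₂ b', Matrix.toEuclideanLin S
        (c n • ((a : EIso (Fin d₁ ⊕ Fin d₂)) ^ n) x₀)⟫ := by
    intro n hn
    have hp := ha.pow n
    rw [translation_pow] at hp
    rw [map_smul, inner_smul_right, ← mul_add, ← inner_add_right,
      ← LinearIsometryEquiv.inner_map_map (rot ((a ^ n : G) : EIso (Fin d₁ ⊕ Fin d₂))), hw n hn,
      SubgroupClass.coe_pow, hp.rot_inrVec_of_translation, map_sub]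
    congr 2
    abel
  rw [diffOp_apply, Finset.sum_congr rfl h1, Finset.sum_add_distrib, ← Finset.sum_mul, hc,
    zero_mul, zero_add, ← inner_sum, ← map_sum, hcb]

/-- Because of this invariance, testing rigidity at all `k` in a finite set `K` costs only the
factor `K.card`. -/
lemma sum_comp_translate {Q : Type} [Group Q] [Fintype Q] (φ : G →* Q) (f : Q → Vec d₁ d₂)
    (k : G) (F : (G → Vec d₁ d₂) → ℝ) :
    ∑ q, F (fun h => f (q * φ (k * h))) = ∑ q, F (fun h => f (q * φ h)) := by
  rw [← Equiv.sum_comp (Equiv.mulRight (φ k)) fun q => F fun h => f (q * φ h)]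
  simp [mul_assoc]

/-- Korn's inequality on finite quotients of `G`, with a uniform constant. -/
theorem exists_korn_bound {S : Subgroup (EIso (Fin d₂))} (hS : IsSpaceGroup S) {T : Set G}
    (hT : IsTranslationSection S T) (hadm : (admissible T).Nonempty) {R R' : Finset G}
    (hR : Property2 x₀ (R : Set G)) {W W' : Type} [NormedAddCommGroup W] [NormedSpace ℝ W]
    [FiniteDimensional ℝ W] [NormedAddCommGroup W'] [NormedSpace ℝ W']
    {Λ : (G → Vec d₁ d₂) →ₗ[ℝ] W} (hΛ : DetectsRigidity x₀ (R : Set G) Λ)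
    {Λ' : (G → Vec d₁ d₂) →ₗ[ℝ] W'} (hΛ' : DetectsRigidity x₀ (R' : Set G) Λ') :
    ∃ C : ℝ, 0 ≤ C ∧ ∀ (Q : Type) [Group Q] [Fintype Q] (φ : G →* Q) (f : Q → Vec d₁ d₂),
      ∑ q, ‖Λ' fun h => f (q * φ h)‖ ^ 2 ≤ C * ∑ q, ‖Λ fun h => f (q * φ h)‖ ^ 2 := by
  classical
  obtain ⟨b, a, hab, hcomm⟩ := exists_commuting_lifts hS hT hadm
  choose s c hc hcb using fun i => (hab i).exists_sum_pow x₀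
  let Θ : Fin d₂ → Fin d₂ → (G → Vec d₁ d₂) →ₗ[ℝ] ℝ := fun i j =>
    diffOp (a i) (s i) (c i) (inrVec d₁ d₂ (b j))
  -- The set contains `R'` and every power sampled by the `Θ i j`, so a single matrix governs both.
  obtain ⟨K, hK⟩ := exists_finset_isRigidOn hR
    (R' ∪ Finset.univ.biUnion fun i => (s i).image fun n => a i ^ n)
  let P : K → (G → Vec d₁ d₂) →ₗ[ℝ] W := fun k =>
    Λ ∘ₗ LinearMap.funLeft ℝ (Vec d₁ d₂) fun h => (k : G) * h
  have hP : ∀ w, (∀ k, P k w = 0) → ∃ v₀, ∃ A ∈ skew (Fin d₁ ⊕ Fin d₂),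
      (∀ h ∈ R', rot (h : EIso (Fin d₁ ⊕ Fin d₂)) (w h) =
        v₀ + Matrix.toEuclideanLin A ((h : EIso (Fin d₁ ⊕ Fin d₂)) x₀ - x₀)) ∧
      ∀ i j, Θ i j w = ⟪inrVec d₁ d₂ (b j), Matrix.toEuclideanLin A (inrVec d₁ d₂ (b i))⟫ := by
    intro w hw
    obtain ⟨v₀, A, hA, h⟩ := hK w fun k hk => hΛ.2 _ (hw ⟨k, hk⟩)
    refine ⟨v₀, A, hA, fun r hr => h r ?_, fun i j => ?_⟩
    · simp [hr]
    · refine diffOp_of_rigid (hab i) (hc i) (hcb i) (v₀ := v₀) fun n hn => h _ ?_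
      simp only [Finset.coe_union, Finset.coe_biUnion, Finset.coe_image]
      exact Or.inr (Set.mem_iUnion₂.2 ⟨i, Finset.mem_coe.2 (Finset.mem_univ i), n, hn, rfl⟩)
  have hsym : ∀ i j, ∃ C : ℝ, 0 ≤ C ∧ ∀ w, ‖(Θ i j + Θ j i) w‖ ^ 2 ≤ C * ∑ k, ‖P k w‖ ^ 2 := by
    intro i j
    -- Skew symmetry makes the symmetric part vanish on rigid motions, so `P` alone controls it and
    -- the second family is empty.
    obtain ⟨C, hC, h⟩ := exists_bound_sq_of_ker_le (κ' := Empty) (W'' := ℝ) P (fun _ => 0)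
      (Θ i j + Θ j i) (fun w hw _ => by
        obtain ⟨v₀, A, hA, -, hΘ⟩ := hP w hw
        rw [LinearMap.add_apply, hΘ, hΘ, mem_skew_iff.1 hA, neg_add_cancel])
    exact ⟨C, hC, fun w => by simpa using h w⟩
  choose C₁ hC₁ hsym using hsym
  -- If `P` and all `Θ i j` vanish, the rotation has zero `d₂ × d₂` block, and `Λ'` annihilates such
  -- motions.
  obtain ⟨C₂, hC₂, hfull⟩ := exists_bound_sq_of_ker_le P
    (fun ij : Fin d₂ × Fin d₂ => Θ ij.1 ij.2) Λ' (fun w hw hΘ0 => by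
      obtain ⟨v₀, A, hA, h, hΘ⟩ := hP w hw
      refine hΛ'.1 w ⟨v₀, A, mem_skewZero_iff.2 ⟨hA, fun y y' => ?_⟩, h⟩
      let B : EuclideanSpace ℝ (Fin d₂) →ₗ[ℝ] EuclideanSpace ℝ (Fin d₂) →ₗ[ℝ] ℝ :=
        (innerₗ (Vec d₁ d₂)).compl₁₂ (inrVec d₁ d₂)
          (Matrix.toEuclideanLin A ∘ₗ inrVec d₁ d₂)
      have hB : B = 0 := b.ext fun j => b.ext fun i => (hΘ i j).symm.trans (hΘ0 (i, j))
      exact LinearMap.congr_fun₂ hB y y')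
  -- One constant for each of the three symmetric sums in `korn_perm`.
  let C₃ : Fin d₂ × Fin d₂ → ℝ := fun ij =>
    C₁ ij.1 ij.2 + C₁ ij.1 ij.1 + C₁ ij.2 ij.2
  have hC₃ : 0 ≤ ∑ ij, C₃ ij := Finset.sum_nonneg fun ij _ =>
    add_nonneg (add_nonneg (hC₁ _ _) (hC₁ _ _)) (hC₁ _ _)
  refine ⟨C₂ * ((1 + ∑ ij, C₃ ij) * K.card), by positivity, fun Q _ _ φ f => ?_⟩
  let w : Q → G → Vec d₁ d₂ := fun q h => f (q * φ h)
  let E := ∑ q, ‖Λ (w q)‖ ^ 2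
  have hE : ∑ q, ∑ k, ‖P k (w q)‖ ^ 2 = K.card * E := by
    have hk : ∀ k, ∑ q, ‖P k (w q)‖ ^ 2 = E := fun k =>
      sum_comp_translate φ f (k : G) fun w => ‖Λ w‖ ^ 2
    rw [Finset.sum_comm, Finset.sum_congr rfl fun k _ => hk k]
    simp
  have hsymE : ∀ i j, ∑ q, (Θ i j (w q) + Θ j i (w q)) ^ 2 ≤ C₁ i j * (K.card * E) := by
    intro i j
    rw [← hE, Finset.mul_sum]
    refine Finset.sum_le_sum fun q _ => ?_
    simpa using hsym i j (w q)
  have hΘE : ∀ ij : Fin d₂ × Fin d₂, ∑ q, ‖Θ ij.1 ij.2 (w q)‖ ^ 2 ≤ C₃ ij * (K.card * E) := by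
    rintro ⟨i, j⟩
    -- The permutations are the right multiplications by `φ (a i)`, which commute because the lifts
    -- do; the functions are the components of `f` along `(0, b j)`.
    have hk := korn_perm (fun i => Equiv.mulRight (φ (a i))) (fun i j => by
      ext q
      simp [Equiv.Perm.mul_apply, mul_assoc, ← map_mul, (hcomm i j).eq]) s c
      (fun j q => ⟪inrVec d₁ d₂ (b j), f q⟫) i j
    have hpow : ∀ i j q, ∑ n ∈ s i, c i n *
        ⟪inrVec d₁ d₂ (b j), f ((Equiv.mulRight (φ (a i)) ^ n) q)⟫ = Θ i j (w q) := by
      intro i j q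
      simp [Θ, diffOp_apply, w]
    simp only [hpow] at hk
    simp only [Real.norm_eq_abs, sq_abs, C₃, add_mul]
    linarith [hsymE i j, hsymE i i, hsymE j j]
  calc ∑ q, ‖Λ' (w q)‖ ^ 2
      ≤ ∑ q, C₂ * (∑ k, ‖P k (w q)‖ ^ 2 + ∑ ij : Fin d₂ × Fin d₂, ‖Θ ij.1 ij.2 (w q)‖ ^ 2) :=
        Finset.sum_le_sum fun q _ => hfull (w q)
    _ = C₂ * (K.card * E + ∑ ij : Fin d₂ × Fin d₂, ∑ q, ‖Θ ij.1 ij.2 (w q)‖ ^ 2) := by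
        rw [← Finset.mul_sum, Finset.sum_add_distrib, hE, Finset.sum_comm (s := Finset.univ (α := Q))]
    _ ≤ C₂ * (K.card * E + ∑ ij, C₃ ij * (K.card * E)) := by
        gcongr with ij
        exact hΘE ij
    _ = _ := by
        rw [← Finset.sum_mul]
        ring

end Korn

/-! ## The kernel -/

section Kernel

variable {d₁ d₂ : ℕ} {G : Subgroup (EIso (Fin d₁ ⊕ Fin d₂))} {x₀ : Vec d₁ d₂}

/-- A bounded function which is locally an infinitesimal rigid motion is a rigid motion that
does not rotate the directions in which the group translates. -/
lemma isRigidOn_univ_of_bounded {S : Subgroup (EIso (Fin d₂))} (hS : IsSpaceGroup S) {T : Set G}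
    (hT : IsTranslationSection S T) {R : Set G} (hR : Property2 x₀ R) {u : G → Vec d₁ d₂}
    (hu : ∀ g, IsRigidOn x₀ (skew _) R fun h => u (g * h)) {M : ℝ} (hM : ∀ g, ‖u g‖ ≤ M) :
    IsRigidOn x₀ (skewZeroZero d₁ d₂) Set.univ u := by
  obtain ⟨c, A, hA, h⟩ := (hu 1).exists_agreesOn
  have hall : ∀ g : G, rot (g : EIso (Fin d₁ ⊕ Fin d₂)) (u g) =
      c + Matrix.toEuclideanLin A ((g : EIso (Fin d₁ ⊕ Fin d₂)) x₀) := by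
    intro g
    obtain ⟨K, hK⟩ := exists_finset_agreesOn hR g
    have := hK u (fun k _ => hu k) c A h 1 hR.one_mem
    rwa [mul_one] at this
  refine ⟨c + Matrix.toEuclideanLin A x₀, A, mem_skewZeroZero_iff.2 ⟨hA, fun y => ?_⟩,
    fun g _ => by rw [hall, map_sub, add_assoc, add_sub_cancel]⟩
  obtain ⟨b, hb⟩ := exists_basis_translation hS
  have hbA : Matrix.toEuclideanLin A ∘ₗ inrVec d₁ d₂ = 0 := by
    refine b.ext fun i => ?_
    obtain ⟨t, ⟨-, ht⟩, -⟩ := hT.2 _ (hb i)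
    have hcont : Continuous (Matrix.toEuclideanLin A) :=
      LinearMap.continuous_of_finiteDimensional _
    have h1 := (hcont.tendsto _).comp (ht.tendsto_inv_smul_pow x₀)
    -- `A (t ^ n x₀) = rot (t ^ n) (u (t ^ n)) - c` is bounded in `n`, so after division by `n` it
    -- tends to `0` as well as to `A (0, b i)`.
    refine tendsto_nhds_unique h1 (squeeze_zero_norm (a := fun n : ℕ => (n : ℝ)⁻¹ * (M + ‖c‖))
      (fun n => ?_) ?_)
    · have h2 := hall (t ^ n)
      rw [Function.comp_apply, map_smul, norm_smul, norm_inv, Real.norm_natCast,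
        ← SubgroupClass.coe_pow, ← sub_eq_iff_eq_add'.2 h2]
      gcongr
      refine (norm_sub_le _ _).trans ?_
      rw [LinearIsometryEquiv.norm_map]
      gcongr
      exact hM _
    · simpa using (tendsto_inv_atTop_nhds_zero_nat (𝕜 := ℝ)).mul_const (M + ‖c‖)
  exact LinearMap.congr_fun hbA y

/-- Seen from `g`, the rotation is conjugated by `rot g`, which maps `0 ⊕ ℝ^{d₂}` to itself; the
matrix vanishes there, so its conjugate has no `d₂ × d₂` block. -/
lemma IsRigidOn.translate {u : G → Vec d₁ d₂}
    (hGP : ∀ g ∈ G, ∃ h, ProjectsTo g h)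
    (H : IsRigidOn x₀ (skewZeroZero d₁ d₂) Set.univ u) (R : Set G) (g : G) :
    IsRigidOn x₀ (skewZero d₁ d₂) R fun h => u (g * h) := by
  obtain ⟨a, A, hA, h⟩ := H
  obtain ⟨hA, hA0⟩ := mem_skewZeroZero_iff.1 hA
  have hag : AgreesOn x₀ R u (a - Matrix.toEuclideanLin A x₀) A g := fun r _ => by
    rw [h _ (Set.mem_univ _), map_sub]
    abel
  refine hag.isRigidOn (mem_skewZero_iff.2 ⟨conj_mem_skew _ hA, fun y y' => ?_⟩)
  obtain ⟨k, hk⟩ := hGP g g.2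
  rw [toEuclideanLin_conj, LinearIsometryEquiv.symm_symm, hk.rot_inrVec, hA0, map_zero,
    inner_zero_right]

end Kernel

/-! ### Comparison and kernels of the averaged seminorms -/

section Averages

variable {d₁ d₂ : ℕ} {G : Subgroup (EIso (Fin d₁ ⊕ Fin d₂))} {x₀ : Vec d₁ d₂}
  {S : Subgroup (EIso (Fin d₂))} {T : Set G} {C : ℕ → Set G}

lemma exists_averageNorm_le (hG : IsDiscreteGroup G) (hS : IsSpaceGroup S)
    (hGS : ∀ g ∈ G, ∃ h ∈ S, ProjectsTo g h) (hT : IsTranslationSection S T)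
    (hx₀ : Function.Injective fun g : G => (g : EIso (Fin d₁ ⊕ Fin d₂)) x₀)
    (hC : IsRepresentationFamily T C) {R R' : Finset G}
    (hR : Property2 x₀ (R : Set G)) {W W' : Type} [NormedAddCommGroup W] [NormedSpace ℝ W]
    [FiniteDimensional ℝ W] [NormedAddCommGroup W'] [NormedSpace ℝ W']
    {Λ : (G → Vec d₁ d₂) →ₗ[ℝ] W} (hΛ : DetectsRigidity x₀ (R : Set G) Λ)
    {Λ' : (G → Vec d₁ d₂) →ₗ[ℝ] W'} (hΛ' : DetectsRigidity x₀ (R' : Set G) Λ') :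
    ∃ B : ℝ, 0 < B ∧ ∀ u ∈ Uper T, averageNorm T C Λ' u ≤ B * averageNorm T C Λ u := by
  -- Without an admissible `N` there are no periodic functions, and no commuting lifts are
  -- available.
  by_cases hadm : (admissible T).Nonempty
  swap
  · exact ⟨1, one_pos, fun u hu => (hadm ⟨_, (period_spec hu).1⟩).elim⟩
  obtain ⟨B, hB, hbound⟩ := exists_korn_bound hS hT hadm hR hΛ hΛ'
  -- The summand `1` keeps the constant positive when `B = 0`.
  refine ⟨√B + 1, by positivity, fun u hu => ?_⟩
  obtain ⟨Q, _, _, φ, f, -, huf, hav⟩ := exists_finite_quotient hG hS hGS hT hx₀ hC hu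
  have hF : ∀ (V : Type) [NormedAddCommGroup V] [NormedSpace ℝ V]
      (L : (G → Vec d₁ d₂) →ₗ[ℝ] V), averageNorm T C L u =
        √((1 / (Fintype.card Q : ℝ)) * ∑ q, ‖L fun h => f (q * φ h)‖ ^ 2) := by
    intro V _ _ L
    rw [averageNorm, hav _ fun q => ‖L fun h => f (q * φ h)‖ ^ 2]
    intro g
    simp only [huf, map_mul]
  rw [hF, hF]
  calc √((1 / (Fintype.card Q : ℝ)) * ∑ q, ‖Λ' fun h => f (q * φ h)‖ ^ 2)
      ≤ √(B * ((1 / (Fintype.card Q : ℝ)) * ∑ q, ‖Λ fun h => f (q * φ h)‖ ^ 2)) := by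
        refine Real.sqrt_le_sqrt ?_
        rw [mul_left_comm]
        gcongr
        exact hbound Q φ f
    _ = √B * √((1 / (Fintype.card Q : ℝ)) * ∑ q, ‖Λ fun h => f (q * φ h)‖ ^ 2) :=
        Real.sqrt_mul hB _
    _ ≤ _ := by
        gcongr
        exact le_add_of_nonneg_right zero_le_one

/-- A mean of squares over the finite quotient vanishes exactly when `Λ` annihilates every translate
of `u`. Finiteness also gives the bound `∑ q, ‖f q‖` on `u` that excludes rotations of the
translation directions. -/
lemma averageNorm_eq_zero_iff (hG : IsDiscreteGroup G) (hS : IsSpaceGroup S)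
    (hGS : ∀ g ∈ G, ∃ h ∈ S, ProjectsTo g h) (hT : IsTranslationSection S T)
    (hx₀ : Function.Injective fun g : G => (g : EIso (Fin d₁ ⊕ Fin d₂)) x₀)
    (hC : IsRepresentationFamily T C) {R : Finset G}
    (hR : Property2 x₀ (R : Set G)) {W : Type} [NormedAddCommGroup W] [NormedSpace ℝ W]
    {Λ : (G → Vec d₁ d₂) →ₗ[ℝ] W} (hΛ : DetectsRigidity x₀ (R : Set G) Λ)
    {u : G → Vec d₁ d₂} (hu : u ∈ Uper T) :
    averageNorm T C Λ u = 0 ↔ u ∈ Uiso00 x₀ := by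
  obtain ⟨Q, _, _, φ, f, hφ, huf, hav⟩ := exists_finite_quotient hG hS hGS hT hx₀ hC hu
  have hF : averageNorm T C Λ u = 0 ↔ ∀ g, (Λ fun h => u (g * h)) = 0 := by
    rw [averageNorm, hav _ fun q => ‖Λ fun h => f (q * φ h)‖ ^ 2]
    · have hcard : (0 : ℝ) < Fintype.card Q := by exact_mod_cast Fintype.card_pos
      rw [Real.sqrt_eq_zero (by positivity), mul_eq_zero, or_iff_right (by positivity),
        Finset.sum_eq_zero_iff_of_nonneg (fun _ _ => by positivity)]
      simp only [Finset.mem_univ, true_imp_iff, hφ.forall, huf, map_mul, ne_eq, OfNat.ofNat_ne_zero,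
        not_false_eq_true, pow_eq_zero_iff, norm_eq_zero]
    · intro g
      simp only [huf, map_mul]
  have hU : u ∈ Uiso00 x₀ ↔ IsRigidOn x₀ (skewZeroZero d₁ d₂) Set.univ u :=
    restrict_mem_Uiso_iff
  rw [hF, hU]
  constructor
  · intro h
    refine isRigidOn_univ_of_bounded hS hT hR (fun g => hΛ.2 _ (h g)) (M := ∑ q, ‖f q‖) fun g => ?_
    rw [huf]
    exact Finset.single_le_sum (f := fun q => ‖f q‖) (fun _ _ => norm_nonneg _)
      (Finset.mem_univ (φ g))
  · intro h g
    exact hΛ.1 _ (h.translate (fun g hg => (hGS g hg).imp fun _ hh => hh.2) _ g)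

end Averages

end ObjStruct

end

/-! ### Equivalence and kernel of the eight seminorms -/

theorem mainTheorem2 {d₁ d₂ : ℕ}
    (G : Subgroup (ObjStruct.EIso (Fin d₁ ⊕ Fin d₂)))
    (S : Subgroup (ObjStruct.EIso (Fin d₂)))
    (hG : ObjStruct.IsDiscreteGroup G)
    (hS : ObjStruct.IsSpaceGroup S)
    (hGS : ∀ g ∈ G, ∃ h ∈ S, ObjStruct.ProjectsTo g h)
    (hSG : ∀ h ∈ S, ∃ g ∈ G, ObjStruct.ProjectsTo g h)
    (T : Set G) (hT : ObjStruct.IsTranslationSection S T)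
    (C : ℕ → Set G) (hC : ObjStruct.IsRepresentationFamily T C)
    (x₀ : ObjStruct.Vec d₁ d₂)
    (hx₀ : Function.Injective fun g : G => (g : ObjStruct.EIso (Fin d₁ ⊕ Fin d₂)) x₀)
    (R₁ R₂ : Finset G)
    (hR₁ : ObjStruct.Property2 x₀ (R₁ : Set G))
    (hR₂ : ObjStruct.Property2 x₀ (R₂ : Set G)) :
    (∀ p ∈ ObjStruct.eightSeminorms T C x₀ R₁ R₂, ∀ q ∈ ObjStruct.eightSeminorms T C x₀ R₁ R₂,
        ObjStruct.EquivalentOn (ObjStruct.Uper T) p q) ∧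
      ∀ p ∈ ObjStruct.eightSeminorms T C x₀ R₁ R₂,
        {u ∈ ObjStruct.Uper T | p u = 0} = ObjStruct.Uiso00 x₀ ∩ ObjStruct.Uper T := by
  constructor
  · intro p hp q hq
    obtain ⟨R, hR, Λ, hΛ, rfl⟩ := ObjStruct.exists_averageNorm_of_mem_eightSeminorms hR₁ hR₂ hp
    obtain ⟨R', hR', Λ', hΛ', rfl⟩ := ObjStruct.exists_averageNorm_of_mem_eightSeminorms hR₁ hR₂ hq
    obtain ⟨B, hB, h⟩ := ObjStruct.exists_averageNorm_le hG hS hGS hT hx₀ hC hR hΛ hΛ'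
    obtain ⟨B', hB', h'⟩ := ObjStruct.exists_averageNorm_le hG hS hGS hT hx₀ hC hR' hΛ' hΛ
    refine ⟨B'⁻¹, B, inv_pos.2 hB', hB, fun u hu => ⟨?_, h u hu⟩⟩
    rw [inv_mul_le_iff₀ hB']
    exact h' u hu
  · intro p hp
    obtain ⟨R, hR, Λ, hΛ, rfl⟩ := ObjStruct.exists_averageNorm_of_mem_eightSeminorms hR₁ hR₂ hp
    ext u
    rw [Set.mem_inter_iff, and_comm (a := u ∈ ObjStruct.Uiso00 x₀)]
    exact and_congr_right fun hu =>
      ObjStruct.averageNorm_eq_zero_iff hG hS hGS hT hx₀ hC hR hΛ hu
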